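/- Let $\eta(\tau)=q^{1/24}\prod_{n\ge 1}(1-q^n)$, $q=e^{2\pi i\tau}$, be the Dedekind eta function on the upper half-plane $\mathbb{H}$. For $\alpha\ge 1$ put $M=3^{2\alpha+1}$ and $$P_\alpha^{\mathrm{ped}}(\tau)=\frac{\eta(6M\tau)^4}{\eta(M\tau)^2\,\eta(3M\tau)\,\eta(12M\tau)}\cdot\frac{\eta(4\tau)}{\eta(\tau)},$$ $$P_\alpha^{\mathrm{pod}}(\tau)=\frac{\eta(2M\tau)^4\,\eta(4M\tau)^6}{\eta(M\tau)^4\,\eta(3M\tau)^3\,\eta(6M\tau)\,\eta(12M\tau)}\cdot\frac{\eta(2\tau)}{\eta(\tau)\,\eta(4\tau)},$$ $$P_\alpha^{\overline{p_o}}(\tau)=\frac{\eta(6M\tau)\,\eta(12M\tau)}{\eta(M\tau)^2}\cdot\frac{\eta(2\tau)^3}{\eta(\tau)^2\,\eta(4\tau)},$$ $$P_\alpha^{\overline{p}}(\tau)=\frac{\eta(2M\tau)^{22}\,\eta(12M\tau)}{\eta(M\tau)^{10}\,\eta(3M\tau)^2\,\eta(4M\tau)^6\,\eta(6M\tau)^4}\cdot\frac{\eta(4\tau)}{\eta(2\tau)^2}.$$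 Let $U_3$ be Atkin's operator $\sum_n a(n)q^n\mapsto\sum_n a(3n)q^n$, and for $*\in\{\mathrm{ped},\mathrm{pod},\overline{p_o},\overline{p}\}$ let $L_\alpha^{*}=U_3^{2\alpha+1}(P_\alpha^{*})$, where $U_3^{2\alpha+1}$ denotes the $(2\alpha+1)$-fold iterate. Let $$\nu=\begin{pmatrix}1&1/2\\0&1\end{pmatrix},\qquad W=\begin{pmatrix}4&-1\\12\cdot 3^{2\alpha+1}&1-3^{2\alpha+2}\end{pmatrix},\qquad \gamma=\nu W\nu,$$ and let $(f\mid\gamma)(\tau)=f(\gamma\tau)$, where $\gamma$ acts on $\mathbb{H}$ by the Möbius transformation. Then for every $\alpha\ge 1$, as functions on $\mathbb{H}$, $$L_\alpha^{\mathrm{ped}}\mid\gamma=(-1)^{\alpha}\,L_\alpha^{\overline{p_o}},\qquad L_\alpha^{\mathrm{pod}}\mid\gamma=(-1)^{\alpha}\,\tfrac14\,L_\alpha^{\overline{p}}.$$ -/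

import Mathlib

open UpperHalfPlane

namespace PartitionLink

/-- The nome `q = e^{2πiτ}`. -/
noncomputable def nome (τ : ℍ) : ℂ := Complex.exp (2 * Real.pi * Complex.I * (τ : ℂ))

/-- The `n`-th Fourier coefficient `a(n)` of a `1`-periodic function `f(τ) = ∑ a(n) qⁿ` on the upper
half-plane, `a(n) = ∫₀¹ f(x + i) e^{-2πin(x + i)} dx`. See `qCoeff_eq` below. -/
noncomputable def qCoeff (f : ℍ → ℂ) (n : ℤ) : ℂ :=
  ∫ x in (0 : ℝ)..1, f (x +ᵥ UpperHalfPlane.I) * (nome (x +ᵥ UpperHalfPlane.I)) ^ (-n)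

/-- Atkin's operator `U_d : ∑ a(n) qⁿ ↦ ∑ a(dn) qⁿ`, as an operator on functions on the
upper half-plane. See `hasSum_U` below for the convergence of the sum. -/
noncomputable def U (d : ℕ) (f : ℍ → ℂ) (τ : ℍ) : ℂ :=
  ∑' n : ℤ, qCoeff f (d * n) * nome τ ^ n

theorem nome_ne_zero (τ : ℍ) : nome τ ≠ 0 := Complex.exp_ne_zero _

theorem nome_vadd_I (x : ℝ) : nome (x +ᵥ UpperHalfPlane.I) =
    nome UpperHalfPlane.I * Complex.exp (2 * Real.pi * Complex.I * x) := by
  simp only [nome, ← Complex.exp_add, UpperHalfPlane.coe_vadd]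
  congr 1; ring

theorem norm_nome_vadd_I (x : ℝ) :
    ‖nome (x +ᵥ UpperHalfPlane.I)‖ = ‖nome UpperHalfPlane.I‖ := by
  rw [nome_vadd_I, norm_mul]
  have : (2 * Real.pi * Complex.I * x : ℂ) = ((2 * Real.pi * x : ℝ) : ℂ) * Complex.I := by
    push_cast; ring
  rw [this, Complex.norm_exp_ofReal_mul_I, mul_one]

theorem integral_nome_zpow (m : ℤ) :
    ∫ x in (0 : ℝ)..1, (nome (x +ᵥ UpperHalfPlane.I)) ^ m = if m = 0 then 1 else 0 := by
  split_ifs with h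
  · simp [h]
  · have hc : (2 * Real.pi * Complex.I * m : ℂ) ≠ 0 := by
      simp [h, Real.pi_ne_zero]
    have he : ∀ x : ℝ, (nome (x +ᵥ UpperHalfPlane.I)) ^ m
        = nome UpperHalfPlane.I ^ m * Complex.exp ((2 * Real.pi * Complex.I * m) * x) := by
      intro x
      rw [nome_vadd_I, mul_zpow, ← Complex.exp_int_mul]
      congr 2; ring
    simp_rw [he]
    rw [intervalIntegral.integral_const_mul, integral_exp_mul_complex hc]
    have : Complex.exp (2 * Real.pi * Complex.I * m) = 1 := by
      rw [Complex.exp_eq_one_iff]; exact ⟨m, by ring⟩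
    simp [this]

/-- If `f(τ) = ∑ a(n) qⁿ` on the upper half-plane, then `qCoeff f` is the sequence `a`. -/
theorem qCoeff_eq {f : ℍ → ℂ} {a : ℤ → ℂ} (hf : ∀ τ, HasSum (fun n : ℤ => a n * nome τ ^ n) (f τ))
    (k : ℤ) : qCoeff f k = a k := by
  have hcont : Continuous fun x : ℝ => nome (x +ᵥ UpperHalfPlane.I) := by
    simp_rw [nome_vadd_I]; fun_prop
  have hterm : ∀ n : ℤ, Continuous fun x : ℝ =>
      a n * nome (x +ᵥ UpperHalfPlane.I) ^ n * nome (x +ᵥ UpperHalfPlane.I) ^ (-k) := by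
    intro n
    exact (continuous_const.mul (hcont.zpow₀ n fun x => Or.inl (nome_ne_zero _))).mul
      (hcont.zpow₀ (-k) fun x => Or.inl (nome_ne_zero _))
  have hsum : HasSum (fun n : ℤ => ∫ x in (0 : ℝ)..1,
      a n * nome (x +ᵥ UpperHalfPlane.I) ^ n * nome (x +ᵥ UpperHalfPlane.I) ^ (-k))
      (qCoeff f k) := by
    refine intervalIntegral.hasSum_integral_of_dominated_convergence
      (bound := fun n _ => ‖a n * nome UpperHalfPlane.I ^ n‖ * ‖nome UpperHalfPlane.I ^ (-k)‖)
      (fun n => (hterm n).aestronglyMeasurable) ?_ ?_ ?_ ?_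
    · intro n
      refine Filter.Eventually.of_forall fun x _ => le_of_eq ?_
      simp only [norm_mul, norm_zpow, norm_nome_vadd_I]
    · exact Filter.Eventually.of_forall fun x _ =>
        ((hf UpperHalfPlane.I).summable.norm).mul_right _
    · exact intervalIntegrable_const
    · exact Filter.Eventually.of_forall fun x _ => (hf _).mul_right _
  have hval : ∀ n : ℤ, (∫ x in (0 : ℝ)..1,
      a n * nome (x +ᵥ UpperHalfPlane.I) ^ n * nome (x +ᵥ UpperHalfPlane.I) ^ (-k))
      = if n = k then a k else 0 := by
    intro n
    have : ∀ x : ℝ, a n * nome (x +ᵥ UpperHalfPlane.I) ^ n * nome (x +ᵥ UpperHalfPlane.I) ^ (-k)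
        = a n * nome (x +ᵥ UpperHalfPlane.I) ^ (n - k) := by
      intro x; rw [mul_assoc, ← zpow_add₀ (nome_ne_zero _), sub_eq_add_neg]
    simp_rw [this]
    rw [intervalIntegral.integral_const_mul, integral_nome_zpow]
    by_cases h : n = k
    · simp [h]
    · simp [h, sub_ne_zero.mpr h]
  simp_rw [hval] at hsum
  exact hsum.unique (by simpa using hasSum_ite_eq k (a k))

/-- If `f(τ) = ∑ a(n) qⁿ` on the upper half-plane, then `(U_d f)(τ) = ∑ a(dn) qⁿ`, and that sum
converges, for every `d ≥ 1`. -/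
theorem hasSum_U {f : ℍ → ℂ} {a : ℤ → ℂ} (hf : ∀ τ, HasSum (fun n : ℤ => a n * nome τ ^ n) (f τ))
    {d : ℕ} (hd : 0 < d) (τ : ℍ) : HasSum (fun n : ℤ => a (d * n) * nome τ ^ n) (U d f τ) := by
  have hd' : (0 : ℝ) < d := by exact_mod_cast hd
  let σ : ℍ := ⟨(τ : ℂ) / d, by
    have h : ((τ : ℂ) / (d : ℂ)).im = τ.im / d := by
      rw [show (d : ℂ) = ((d : ℝ) : ℂ) by simp, Complex.div_ofReal_im]; rfl
    rw [h]; exact div_pos τ.im_pos hd'⟩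
  have hσ : nome σ ^ (d : ℤ) = nome τ := by
    have hdc : (d : ℂ) ≠ 0 := by exact_mod_cast hd.ne'
    have hc : (σ : ℂ) = (τ : ℂ) / d := rfl
    rw [nome, nome, ← Complex.exp_int_mul, hc]
    congr 1
    push_cast
    field_simp
  have hinj : Function.Injective fun n : ℤ => (d : ℤ) * n := fun m n h => by
    have : (d : ℤ) ≠ 0 := by exact_mod_cast hd.ne'
    exact mul_left_cancel₀ this h
  have hs : Summable fun n : ℤ => a (d * n) * nome τ ^ n := by
    have := (hf σ).summable.comp_injective hinj
    refine this.congr fun n => ?_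
    simp only [Function.comp, zpow_mul, hσ]
  have hU : U d f τ = ∑' n : ℤ, a (d * n) * nome τ ^ n := by
    simp only [U, qCoeff_eq hf]
  rw [hU]
  exact hs.hasSum

/-- `τ ↦ η(δτ)`, for the Dedekind eta function `η(τ) = q^{1/24} ∏_{n ≥ 1} (1 - qⁿ)`. -/
noncomputable def etaAt (δ : ℕ) (τ : ℍ) : ℂ := ModularForm.eta ((δ : ℂ) * (τ : ℂ))

/-- The modular function `P_α^{ped}`. -/
noncomputable def Pped (α : ℕ) (τ : ℍ) : ℂ :=
  etaAt (6 * 3 ^ (2 * α + 1)) τ ^ 4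
      / (etaAt (3 ^ (2 * α + 1)) τ ^ 2 * etaAt (3 * 3 ^ (2 * α + 1)) τ
        * etaAt (12 * 3 ^ (2 * α + 1)) τ)
    * (etaAt 4 τ / etaAt 1 τ)

/-- The modular function `P_α^{pod}`. -/
noncomputable def Ppod (α : ℕ) (τ : ℍ) : ℂ :=
  etaAt (2 * 3 ^ (2 * α + 1)) τ ^ 4 * etaAt (4 * 3 ^ (2 * α + 1)) τ ^ 6
      / (etaAt (3 ^ (2 * α + 1)) τ ^ 4 * etaAt (3 * 3 ^ (2 * α + 1)) τ ^ 3
        * etaAt (6 * 3 ^ (2 * α + 1)) τ * etaAt (12 * 3 ^ (2 * α + 1)) τ)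
    * (etaAt 2 τ / (etaAt 1 τ * etaAt 4 τ))

/-- The modular function `P_α` attached to overpartitions into odd parts. -/
noncomputable def Ppobar (α : ℕ) (τ : ℍ) : ℂ :=
  etaAt (6 * 3 ^ (2 * α + 1)) τ * etaAt (12 * 3 ^ (2 * α + 1)) τ
      / etaAt (3 ^ (2 * α + 1)) τ ^ 2
    * (etaAt 2 τ ^ 3 / (etaAt 1 τ ^ 2 * etaAt 4 τ))

/-- The modular function `P_α` attached to overpartitions. -/
noncomputable def Ppbar (α : ℕ) (τ : ℍ) : ℂ :=
  etaAt (2 * 3 ^ (2 * α + 1)) τ ^ 22 * etaAt (12 * 3 ^ (2 * α + 1)) τ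
      / (etaAt (3 ^ (2 * α + 1)) τ ^ 10 * etaAt (3 * 3 ^ (2 * α + 1)) τ ^ 2
        * etaAt (4 * 3 ^ (2 * α + 1)) τ ^ 6 * etaAt (6 * 3 ^ (2 * α + 1)) τ ^ 4)
    * (etaAt 4 τ / etaAt 2 τ ^ 2)

/-- `L_α^{ped} = U_3^{2α+1}(P_α^{ped})`. -/
noncomputable def Lped (α : ℕ) : ℍ → ℂ := (U 3)^[2 * α + 1] (Pped α)

/-- `L_α^{pod} = U_3^{2α+1}(P_α^{pod})`. -/
noncomputable def Lpod (α : ℕ) : ℍ → ℂ := (U 3)^[2 * α + 1] (Ppod α)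

/-- `L_α = U_3^{2α+1}(P_α)` for overpartitions into odd parts. -/
noncomputable def Lpobar (α : ℕ) : ℍ → ℂ := (U 3)^[2 * α + 1] (Ppobar α)

/-- `L_α = U_3^{2α+1}(P_α)` for overpartitions. -/
noncomputable def Lpbar (α : ℕ) : ℍ → ℂ := (U 3)^[2 * α + 1] (Ppbar α)

/-- The matrix `ν`, acting by `τ ↦ τ + 1/2`, that is `q ↦ -q`. -/
noncomputable def nu : GL (Fin 2) ℝ :=
  Matrix.GeneralLinearGroup.mkOfDetNeZero !![1, 1 / 2; 0, 1] (by simp)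

/-- The Atkin–Lehner matrix `W` of determinant `4` at level `12 · 3^{2α+1}`. -/
noncomputable def W (α : ℕ) : GL (Fin 2) ℝ :=
  Matrix.GeneralLinearGroup.mkOfDetNeZero
    !![4, -1; 12 * 3 ^ (2 * α + 1), 1 - 3 ^ (2 * α + 2)] (by
      have h : Matrix.det !![(4 : ℝ), -1; 12 * 3 ^ (2 * α + 1), 1 - 3 ^ (2 * α + 2)] = 4 := by
        rw [Matrix.det_fin_two_of]; ring
      rw [h]; norm_num)

/-- The conjugated Atkin–Lehner matrix `γ = νWν`. -/
noncomputable def gam (α : ℕ) : GL (Fin 2) ℝ := nu * W α * nu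

/-- `γ = νWν` is twice a matrix (of determinant `1`), which therefore induces the same Möbius
transformation. -/
theorem gam_val (α : ℕ) : (gam α : Matrix (Fin 2) (Fin 2) ℝ) =
    (2 : ℝ) • !![2 + 3 * 3 ^ (2 * α + 1), (3 + 3 ^ (2 * α + 2)) / 4;
      6 * 3 ^ (2 * α + 1), (1 + 3 ^ (2 * α + 2)) / 2] := by
  simp only [gam, nu, W, Units.val_mul, Matrix.GeneralLinearGroup.mkOfDetNeZero,
    Matrix.GeneralLinearGroup.mk', Matrix.unitOfDetInvertible]
  ext i j
  fin_cases i <;> fin_cases j <;> simp [Matrix.mul_apply, Fin.sum_univ_two] <;> ring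

/-- The weight-zero action of a matrix on a function on the upper half-plane by Möbius
substitution, `(f | g)(τ) = f(gτ)`. -/
noncomputable def act (f : ℍ → ℂ) (g : GL (Fin 2) ℝ) : ℍ → ℂ := fun τ => f (g • τ)

end PartitionLink

namespace PartitionLink

/-! Write M = 3^(2α+1). The (2α+1)-fold iterate of U_3 sends f to the average of f((τ+j)/M) over any
complete residue system j mod M (`HasQSeries.iterate_U_eq`, `HasQSeries.sum_reindex`). It therefore
suffices to match translates of γτ with translates of τ. As a Möbius map γ comes from an integral
matrix of determinant 1, and for each n there is an m with (γτ+8m)/M = A((τ+8n)/M), where A is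
integral of determinant 1 with lower left entry 6M², and n ↦ m permutes the residues mod M. By
`iterate_U_link` the theorem follows once each P transforms correctly under every such A
(`ped_transform`, `pod_transform`). Shifting by multiples of 8 fixes the diagonal of A mod 48, so
the roots of unity do not depend on n.

For m dividing 6M², m·Aw = A'(mw) with A' of lower left entry 6M²/m. Dedekind sums are avoided by
writing each P through three kinds of factors: squares η(mz)², whose multiplier is a character of
order 12 (`eta_sq_mob`); η(4z)/η(z), of weight 0 with a character of order 8 on Γ₀(4)
(`fourQuot_mob_gammaZeroFour`); and η(z)η(4z)/η(2z), of weight 1/2 with a Jacobi symbol in its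
multiplier (`psiLaw`). The last two are needed only at mz with m = 1, M, 3M, where A' is a Γ₀(4)
element times (1 0; 2 1). That lower triangular factor carries each quotient to its form at the cusp
1/2, which is how ped becomes overpartitions into odd parts and pod becomes overpartitions.

The automorphy factors cancel, and 1/4 is left over from powers of √2. For pod the two Jacobi
symbols multiply to the symbol of 12M³, a square because 3M is one (`jac_mul_jac`). With M = 27 +
216k, the roots of unity multiply to (-1)^(k+1) = (-1)^α. -/

open ModularForm

/-! ### Roots of unity of order dividing 48 -/

/-- `rou n = e^{2πin/48}`. -/
noncomputable def rou (n : ℤ) : ℂ := Complex.exp (2 * Real.pi * Complex.I * n / 48)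

theorem rou_ne_zero (n : ℤ) : rou n ≠ 0 := Complex.exp_ne_zero _

theorem rou_add (m n : ℤ) : rou (m + n) = rou m * rou n := by
  rw [rou, rou, rou, ← Complex.exp_add]; congr 1; push_cast; ring

theorem rou_zero : rou 0 = 1 := by simp [rou]

theorem rou_neg (n : ℤ) : rou (-n) = (rou n)⁻¹ :=
  eq_inv_of_mul_eq_one_left (by rw [← rou_add, neg_add_cancel, rou_zero])

theorem rou_sub (m n : ℤ) : rou (m - n) = rou m / rou n := by
  rw [sub_eq_add_neg, rou_add, rou_neg, div_eq_mul_inv]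

theorem rou_mul_nat (m : ℤ) (n : ℕ) : rou (n * m) = rou m ^ n := by
  induction n with
  | zero => simp [rou_zero]
  | succ n ih => rw [pow_succ, ← ih, ← rou_add]; congr 1; push_cast; ring

theorem rou_of_dvd {n : ℤ} (h : 48 ∣ n) : rou n = 1 := by
  obtain ⟨k, rfl⟩ := h
  rw [rou, Complex.exp_eq_one_iff]
  exact ⟨k, by push_cast; ring⟩

theorem rou_congr {m n : ℤ} (h : 48 ∣ m - n) : rou m = rou n := by
  have := rou_of_dvd h
  rwa [rou_sub, div_eq_one_iff_eq (rou_ne_zero n)] at this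

theorem rou_24 : rou 24 = -1 := by
  rw [rou, show (2 * Real.pi * Complex.I * (24 : ℤ) / 48 : ℂ) = Real.pi * Complex.I by
    push_cast; ring, Complex.exp_pi_mul_I]

theorem rou_12 : rou 12 = Complex.I := by
  rw [rou, show (2 * Real.pi * Complex.I * (12 : ℤ) / 48 : ℂ) = Real.pi / 2 * Complex.I by
    push_cast; ring, Complex.exp_pi_div_two_mul_I]

/-! ### The principal square root -/

theorem sqrt_mul_self (z : ℂ) : Complex.sqrt z * Complex.sqrt z = z := by
  rw [Complex.sqrt, ← pow_two, ← Nat.cast_ofNat (R := ℂ), Complex.cpow_nat_inv_pow z two_ne_zero]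

theorem sqrt_ne_zero {z : ℂ} (hz : z ≠ 0) : Complex.sqrt z ≠ 0 := fun h => by
  apply hz; rw [← sqrt_mul_self z, h, zero_mul]

theorem sqrt_mul {a b : ℂ} (ha : a ≠ 0) (hb : b ≠ 0)
    (h : a.arg + b.arg ∈ Set.Ioc (-Real.pi) Real.pi) :
    Complex.sqrt (a * b) = Complex.sqrt a * Complex.sqrt b := by
  rw [sqrt_eq_exp (mul_ne_zero ha hb), sqrt_eq_exp ha, sqrt_eq_exp hb, ← Complex.exp_add,
    Complex.log_mul ha hb h, add_div]

theorem sqrt_ofReal_mul {r : ℝ} (hr : 0 < r) {z : ℂ} (hz : z ≠ 0) :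
    Complex.sqrt (r * z) = Complex.sqrt r * Complex.sqrt z := by
  refine sqrt_mul (by exact_mod_cast hr.ne') hz ?_
  rw [Complex.arg_ofReal_of_nonneg hr.le, zero_add]
  exact Complex.arg_mem_Ioc z

theorem ne_zero_of_im_pos {z : ℂ} (hz : 0 < z.im) : z ≠ 0 := fun h => by simp [h] at hz

theorem arg_mem_Ioo {z : ℂ} (hz : 0 < z.im) : z.arg ∈ Set.Ioo 0 Real.pi := by
  refine ⟨lt_of_le_of_ne (Complex.arg_nonneg_iff.2 hz.le) fun h => ?_,
    Complex.arg_lt_pi_iff.2 (Or.inr hz.ne')⟩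
  exact hz.ne' (Complex.arg_eq_zero_iff.1 h.symm).2

/-- Both arguments lie in (0, π), so their difference avoids the branch cut. Other roots are handled
by reducing them to points of the upper half-plane. -/
theorem sqrt_div {a b : ℂ} (ha : 0 < a.im) (hb : 0 < b.im) :
    Complex.sqrt (a / b) = Complex.sqrt a / Complex.sqrt b := by
  have hb0 := ne_zero_of_im_pos hb
  have h1 := arg_mem_Ioo ha
  have h2 := arg_mem_Ioo hb
  have hinv : Complex.sqrt b⁻¹ = (Complex.sqrt b)⁻¹ := by
    rw [sqrt_eq_exp hb0, sqrt_eq_exp (inv_ne_zero hb0), ← Complex.exp_neg,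
      Complex.log_inv _ h2.2.ne, neg_div]
  rw [div_eq_mul_inv, sqrt_mul (ne_zero_of_im_pos ha) (inv_ne_zero hb0), hinv, div_eq_mul_inv]
  rw [Complex.arg_inv, if_neg h2.2.ne]
  exact ⟨by linarith [h1.1, h2.2], by linarith [h1.2, h2.1]⟩

theorem exp_half_pi_I : Complex.exp (Real.pi * Complex.I / 2) = Complex.I := by
  rw [show (Real.pi * Complex.I / 2 : ℂ) = Real.pi / 2 * Complex.I by ring,
    Complex.exp_pi_div_two_mul_I]

theorem log_neg_of_im_neg {z : ℂ} (hz : z.im < 0) :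
    Complex.log (-z) = Complex.log z + Real.pi * Complex.I := by
  rw [Complex.log, Complex.log, norm_neg, Complex.arg_neg_eq_arg_add_pi_of_im_neg hz]
  push_cast; ring

theorem sqrt_neg_of_im_neg {z : ℂ} (hz : z.im < 0) :
    Complex.sqrt (-z) = Complex.I * Complex.sqrt z := by
  have h0 : z ≠ 0 := fun h => by simp [h] at hz
  rw [sqrt_eq_exp h0, sqrt_eq_exp (neg_ne_zero.2 h0), log_neg_of_im_neg hz, add_div,
    Complex.exp_add, exp_half_pi_I, mul_comm]

theorem sqrt_neg_of_im_pos {z : ℂ} (hz : 0 < z.im) :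
    Complex.sqrt (-z) = -Complex.I * Complex.sqrt z := by
  have := sqrt_neg_of_im_neg (z := -z) (by simpa using hz)
  rw [neg_neg] at this
  rw [this, ← mul_assoc, neg_mul, Complex.I_mul_I, neg_neg, one_mul]

theorem im_neg_one_div_pos {z : ℂ} (hz : 0 < z.im) : 0 < (-1 / z).im := by
  rw [neg_div, one_div]
  simpa using UpperHalfPlane.im_inv_neg_coe_pos ⟨z, hz⟩

theorem sqrt_neg_one_div_mul {z : ℂ} (hz : 0 < z.im) :
    Complex.sqrt (-1 / z) * Complex.sqrt z = Complex.I := by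
  have h0 := ne_zero_of_im_pos hz
  have h2 := arg_mem_Ioo hz
  have hl : Complex.log (-1 / z) = -Complex.log z + Real.pi * Complex.I := by
    rw [← Complex.log_inv _ h2.2.ne, ← log_neg_of_im_neg]
    · congr 1; field_simp
    · have := im_neg_one_div_pos hz
      rw [show (-1 / z) = -(z⁻¹) by field_simp, Complex.neg_im] at this
      linarith
  rw [sqrt_eq_exp h0, sqrt_eq_exp (ne_zero_of_im_pos (im_neg_one_div_pos hz)), hl,
    ← Complex.exp_add]
  exact (congrArg Complex.exp (by ring)).trans exp_half_pi_I

theorem im_sub_ofReal {w : ℂ} (x : ℝ) : (w - x).im = w.im := by simp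

/-- With `w = -1/z`, one has `1 + xz = (w - x)/w`; the principal roots agree as well. -/
theorem sqrt_one_add_mul {z : ℂ} (hz : 0 < z.im) (x : ℝ) :
    Complex.sqrt (x * z + 1) = Complex.sqrt (-1 / z - x) / Complex.sqrt (-1 / z) := by
  have h := im_neg_one_div_pos hz
  rw [← sqrt_div (by rwa [im_sub_ofReal]) h]
  congr 1
  have := ne_zero_of_im_pos hz
  field_simp; ring

/-- The cocycle relation for `√(cz + d)`, `d > 0`, under `z ↦ z/(mz + 1)`. -/
theorem sqrt_cocycle {z : ℂ} (hz : 0 < z.im) {c d m : ℝ} (hd : 0 < d) (_hm : (m * z + 1 : ℂ) ≠ 0) :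
    Complex.sqrt (c * (z / (m * z + 1)) + d) * Complex.sqrt (m * z + 1)
      = Complex.sqrt ((c + d * m : ℝ) * z + d) := by
  have h0 := ne_zero_of_im_pos hz
  have hw := im_neg_one_div_pos hz
  have hdc : (d : ℂ) ≠ 0 := by exact_mod_cast hd.ne'
  -- In the coordinate -1/z the map z ↦ z/(mz+1) is translation by -m, so each root becomes a
  -- quotient of roots of upper half-plane points and the middle one cancels.
  have hv : -1 / (z / (m * z + 1)) = -1 / z - m := by field_simp; ring
  have hv0 : 0 < (z / (m * z + 1)).im := by
    have h1 : 0 < (-1 / z - m).im := by rwa [im_sub_ofReal]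
    have h2 := im_neg_one_div_pos h1
    rwa [← hv, show ∀ x : ℂ, -1 / (-1 / x) = x by intro x; simp [neg_div]] at h2
  have key : ∀ (e : ℝ) {u : ℂ}, 0 < u.im → Complex.sqrt (e * u + d)
      = Complex.sqrt d * (Complex.sqrt (-1 / u - (e / d : ℝ)) / Complex.sqrt (-1 / u)) := by
    intro e u hu
    rw [← sqrt_one_add_mul hu, ← sqrt_ofReal_mul hd]
    · congr 1; push_cast; field_simp
    · have h3 : ((e / d : ℝ) * u + 1 : ℂ) = (-1 / u - (e / d : ℝ)) / (-1 / u) := by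
        have := ne_zero_of_im_pos hu
        field_simp; ring
      rw [h3]
      refine div_ne_zero (ne_zero_of_im_pos ?_) (ne_zero_of_im_pos (im_neg_one_div_pos hu))
      rw [im_sub_ofReal]; exact im_neg_one_div_pos hu
  rw [key c hv0, key _ hz, hv, sqrt_one_add_mul hz m]
  have h4 : Complex.sqrt (-1 / z - m) ≠ 0 :=
    sqrt_ne_zero (ne_zero_of_im_pos (by rwa [im_sub_ofReal]))
  have h5 : (-1 / z - m - (c / d : ℝ) : ℂ) = -1 / z - ((c + d * m) / d : ℝ) := by
    push_cast; field_simp; ring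
  rw [h5]
  generalize Complex.sqrt (-1 / z - m) = x at h4 ⊢
  generalize Complex.sqrt (-1 / z) = y
  field_simp

/-! ### Translation and inversion of the eta function -/

theorem eta_ne_zero' {z : ℂ} (hz : 0 < z.im) : eta z ≠ 0 := eta_ne_zero hz

theorem eta_add_int (z : ℂ) (n : ℤ) : eta (z + n) = rou (2 * n) * eta z := by
  have h1 : Function.Periodic.qParam 1 (z + n) = Function.Periodic.qParam 1 z := by
    simp only [Function.Periodic.qParam]
    rw [show (2 * Real.pi * Complex.I * (z + n) / (1 : ℝ) : ℂ)
      = 2 * Real.pi * Complex.I * z / (1 : ℝ) + n * (2 * Real.pi * Complex.I) by push_cast; ring]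
    rw [Complex.exp_add, Complex.exp_int_mul_two_pi_mul_I, mul_one]
  have h2 : Function.Periodic.qParam 24 (z + n) = rou (2 * n) * Function.Periodic.qParam 24 z := by
    simp only [Function.Periodic.qParam, rou]
    rw [← Complex.exp_add]; congr 1; push_cast; ring
  simp only [eta, eta_q, h1, h2, mul_assoc]

theorem eta_neg_one_div {z : ℂ} (hz : 0 < z.im) :
    eta (-1 / z) = (Complex.sqrt Complex.I)⁻¹ * (Complex.sqrt z * eta z) := by
  simpa using eta_comp_eq_csqrt_I_inv hz

theorem eta_neg_one_div_mul {z : ℂ} (hz : 0 < z.im) {r : ℝ} (hr : 0 < r) :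
    eta (-1 / (r * z)) = (Complex.sqrt Complex.I)⁻¹ *
      (Complex.sqrt r * Complex.sqrt z * eta (r * z)) := by
  rw [eta_neg_one_div (by simpa using mul_pos hr hz), sqrt_ofReal_mul hr (ne_zero_of_im_pos hz)]

theorem sqrt_four : Complex.sqrt ((4 : ℝ) : ℂ) = 2 := by
  rw [show ((4 : ℝ) : ℂ) = (2 : ℝ) * ((2 : ℝ) : ℂ) by norm_num,
    sqrt_ofReal_mul two_pos (by norm_num), sqrt_mul_self]; norm_num

/-! ### The half-integral translate of the eta function -/

theorem tprod_euler_split {q : ℂ} (hq : ‖q‖ < 1) :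
    ∏' n : ℕ, (1 - q ^ (n + 1)) =
      (∏' n : ℕ, (1 - q ^ (2 * n + 1))) * ∏' n : ℕ, (1 - (q ^ 2) ^ (n + 1)) := by
  have hm := multipliable_one_sub_pow hq
  have hq2 : ‖q ^ 2‖ < 1 := by
    rw [norm_pow]; exact pow_lt_one₀ (norm_nonneg _) hq two_ne_zero
  have ho : Multipliable fun n : ℕ => 1 - (q ^ 2) ^ (n + 1) := multipliable_one_sub_pow hq2
  have he : Multipliable fun n : ℕ => 1 - q ^ (2 * n + 1) := by
    have : Summable fun n : ℕ => ‖-q ^ (2 * n + 1)‖ := by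
      have h := (summable_geometric_of_lt_one (norm_nonneg _) hq2).mul_left ‖q‖
      refine h.congr fun n => ?_
      rw [norm_neg, norm_pow, norm_pow, ← pow_mul]; ring
    simpa [sub_eq_add_neg] using multipliable_one_add_of_summable this
  rw [← tprod_even_mul_odd (f := fun n => 1 - q ^ (n + 1)) he (ho.congr fun n => by
    rw [← pow_mul]; congr 2)]
  congr 1
  refine tprod_congr fun n => ?_
  rw [← pow_mul]; congr 2

theorem tprod_odd_mul_neg {q : ℂ} (hq : ‖q‖ < 1) :
    (∏' n : ℕ, (1 - q ^ (2 * n + 1))) * ∏' n : ℕ, (1 - (-q) ^ (2 * n + 1))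
      = ∏' n : ℕ, (1 - (q ^ 2) ^ (2 * n + 1)) := by
  have h : ∀ p : ℂ, ‖p‖ < 1 → Multipliable fun n : ℕ => 1 - p ^ (2 * n + 1) := by
    intro p hp
    have hp2 : ‖p ^ 2‖ < 1 := by
      rw [norm_pow]; exact pow_lt_one₀ (norm_nonneg _) hp two_ne_zero
    have : Summable fun n : ℕ => ‖-p ^ (2 * n + 1)‖ := by
      have h := (summable_geometric_of_lt_one (norm_nonneg _) hp2).mul_left ‖p‖
      refine h.congr fun n => ?_
      rw [norm_neg, norm_pow, norm_pow, ← pow_mul]; ring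
    simpa [sub_eq_add_neg] using multipliable_one_add_of_summable this
  rw [← (h q hq).tprod_mul (h (-q) (by rwa [norm_neg]))]
  refine tprod_congr fun n => ?_
  rw [Odd.neg_pow ⟨n, rfl⟩]; ring

/-- Split each product into odd and even indices: the odd parts at q and -q multiply to the odd part
at q², which is the quotient of the full products at q² and q⁴. -/
theorem tprod_neg {q : ℂ} (hq : ‖q‖ < 1) :
    (∏' n : ℕ, (1 - (-q) ^ (n + 1))) * (∏' n : ℕ, (1 - q ^ (n + 1)))
      * ∏' n : ℕ, (1 - (q ^ 4) ^ (n + 1)) = (∏' n : ℕ, (1 - (q ^ 2) ^ (n + 1))) ^ 3 := by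
  have hq2 : ‖q ^ 2‖ < 1 := by
    rw [norm_pow]; exact pow_lt_one₀ (norm_nonneg _) hq two_ne_zero
  have h1 := tprod_euler_split hq
  have h2 := tprod_euler_split (q := -q) (by rwa [norm_neg])
  have h3 := tprod_euler_split hq2
  have h4 := tprod_odd_mul_neg hq
  rw [neg_sq] at h2
  rw [show (q ^ 2) ^ 2 = q ^ 4 by ring] at h3
  set X := ∏' n : ℕ, (1 - (q ^ 2) ^ (n + 1)) with hX
  clear_value X
  rw [h1, h2]
  rw [← h4] at h3
  linear_combination (-(X ^ 2)) * h3

/-- Here q becomes -q, so `tprod_neg` applies. The prefactor q^(1/24) contributes e^(2πi/48), which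
is why 48th roots of unity are the right setting. -/
theorem eta_add_half {z : ℂ} (hz : 0 < z.im) :
    eta (z + 1 / 2) = rou 1 * eta (2 * z) ^ 3 / (eta z * eta (4 * z)) := by
  have h2 : 0 < (2 * z).im := by simpa using hz
  have h4 : 0 < (4 * z).im := by simpa using hz
  rw [eq_div_iff (mul_ne_zero (eta_ne_zero' hz) (eta_ne_zero' h4))]
  have e1 : Function.Periodic.qParam 1 (z + 1 / 2) = -Function.Periodic.qParam 1 z := by
    simp only [Function.Periodic.qParam]
    rw [show (2 * Real.pi * Complex.I * (z + 1 / 2) / (1 : ℝ) : ℂ)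
      = 2 * Real.pi * Complex.I * z / (1 : ℝ) + Real.pi * Complex.I by push_cast; ring]
    rw [Complex.exp_add, Complex.exp_pi_mul_I]; ring
  have e2 : Function.Periodic.qParam 1 (2 * z) = Function.Periodic.qParam 1 z ^ 2 := by
    simp only [Function.Periodic.qParam]
    rw [← Complex.exp_nat_mul]; congr 1; push_cast; ring
  have e4 : Function.Periodic.qParam 1 (4 * z) = Function.Periodic.qParam 1 z ^ 4 := by
    simp only [Function.Periodic.qParam]
    rw [← Complex.exp_nat_mul]; congr 1; push_cast; ring
  have e24 : Function.Periodic.qParam 24 (z + 1 / 2) * Function.Periodic.qParam 24 z *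
      Function.Periodic.qParam 24 (4 * z) = rou 1 * Function.Periodic.qParam 24 (2 * z) ^ 3 := by
    simp only [Function.Periodic.qParam, rou]
    rw [← Complex.exp_nat_mul, ← Complex.exp_add, ← Complex.exp_add, ← Complex.exp_add]
    congr 1; push_cast; ring
  have hq : ‖Function.Periodic.qParam 1 z‖ < 1 := by
    simpa using norm_qParam_lt_one 1 ⟨z, hz⟩
  have hp := tprod_neg hq
  simp only [eta, eta_q, e1, e2, e4]
  generalize ∏' n : ℕ, (1 - (Function.Periodic.qParam 1 z) ^ (n + 1)) = x at hp ⊢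
  generalize ∏' n : ℕ, (1 - (-Function.Periodic.qParam 1 z) ^ (n + 1)) = y at hp ⊢
  linear_combination (y * x * ∏' n : ℕ, (1 - (Function.Periodic.qParam 1 z ^ 4) ^ (n + 1))) * e24
    + rou 1 * Function.Periodic.qParam 24 (2 * z) ^ 3 * hp

/-! ### Eta quotients of level 4 -/

/-- `η(4z)/η(z)`. -/
noncomputable def fourQuot (z : ℂ) : ℂ := eta (4 * z) / eta z

/-- `η(2z)³/(η(z)²η(4z))`, the form of `fourQuot` at the cusp `1/2`. -/
noncomputable def fourQuotHalf (z : ℂ) : ℂ := eta (2 * z) ^ 3 / (eta z ^ 2 * eta (4 * z))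

/-- `η(z)η(4z)/η(2z)`, a theta series of weight `1/2`. -/
noncomputable def psiQuot (z : ℂ) : ℂ := eta z * eta (4 * z) / eta (2 * z)

/-- `η(2z)²/η(4z)`, the form of `psiQuot` at the cusp `1/2`. -/
noncomputable def psiQuotHalf (z : ℂ) : ℂ := eta (2 * z) ^ 2 / eta (4 * z)

theorem im_natCast_mul_pos {z : ℂ} (hz : 0 < z.im) {n : ℕ} (hn : 0 < n) : 0 < (n * z : ℂ).im := by
  have : (0 : ℝ) < n := by exact_mod_cast hn
  simpa using mul_pos this hz

theorem eta_natCast_mul_ne_zero {z : ℂ} (hz : 0 < z.im) {n : ℕ} (hn : 0 < n) :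
    eta (n * z) ≠ 0 := eta_ne_zero' (im_natCast_mul_pos hz hn)

theorem eta_two_ne {z : ℂ} (hz : 0 < z.im) : eta (2 * z) ≠ 0 :=
  eta_natCast_mul_ne_zero hz (n := 2) (by norm_num)

theorem eta_four_ne {z : ℂ} (hz : 0 < z.im) : eta (4 * z) ≠ 0 :=
  eta_natCast_mul_ne_zero hz (n := 4) (by norm_num)

theorem fourQuot_ne_zero {z : ℂ} (hz : 0 < z.im) : fourQuot z ≠ 0 :=
  div_ne_zero (eta_four_ne hz) (eta_ne_zero' hz)

theorem fourQuot_add_int (z : ℂ) (n : ℤ) : fourQuot (z + n) = rou (6 * n) * fourQuot z := by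
  have h : 4 * (z + n) = 4 * z + (4 * n : ℤ) := by push_cast; ring
  rw [fourQuot, fourQuot, h, eta_add_int, eta_add_int,
    show rou (6 * n) = rou (2 * (4 * n)) / rou (2 * n) by rw [← rou_sub]; congr 1; ring]
  field_simp

theorem psiQuot_add_int (z : ℂ) (n : ℤ) : psiQuot (z + n) = rou (6 * n) * psiQuot z := by
  have h : 4 * (z + n) = 4 * z + (4 * n : ℤ) := by push_cast; ring
  have h' : 2 * (z + n) = 2 * z + (2 * n : ℤ) := by push_cast; ring
  rw [psiQuot, psiQuot, h, h', eta_add_int, eta_add_int, eta_add_int,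
    show rou (6 * n) = rou (2 * n) * rou (2 * (4 * n)) / rou (2 * (2 * n)) by
      rw [← rou_add, ← rou_sub]; congr 1; ring]
  field_simp

theorem sqrt_I_ne_zero : Complex.sqrt Complex.I ≠ 0 := sqrt_ne_zero Complex.I_ne_zero

theorem sqrt_two_mul_self : Complex.sqrt ((2 : ℝ) : ℂ) * Complex.sqrt ((2 : ℝ) : ℂ) = 2 := by
  rw [sqrt_mul_self]; norm_num

theorem sqrt_two_ne_zero : Complex.sqrt ((2 : ℝ) : ℂ) ≠ 0 := sqrt_ne_zero (by norm_num)

theorem eta_inv_two {z : ℂ} (hz : 0 < z.im) :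
    eta (-1 / (2 * z)) = (Complex.sqrt Complex.I)⁻¹ *
      (Complex.sqrt (2 : ℝ) * Complex.sqrt z * eta (2 * z)) := by
  have := eta_neg_one_div_mul hz (r := 2) two_pos
  simpa using this

theorem eta_inv_four {z : ℂ} (hz : 0 < z.im) :
    eta (-1 / (4 * z)) = (Complex.sqrt Complex.I)⁻¹ * (2 * Complex.sqrt z * eta (4 * z)) := by
  have := eta_neg_one_div_mul hz (r := 4) four_pos
  rw [sqrt_four] at this
  simpa using this

theorem im_inv_four_pos {z : ℂ} (hz : 0 < z.im) : 0 < (-1 / (4 * z)).im :=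
  im_neg_one_div_pos (by simpa using hz)

/-- The Fricke involution on `fourQuot`. -/
theorem fourQuot_fricke {z : ℂ} (hz : 0 < z.im) :
    fourQuot z = 1 / (2 * fourQuot (-1 / (4 * z))) := by
  have h0 := ne_zero_of_im_pos hz
  have e : 4 * (-1 / (4 * z)) = -1 / z := by field_simp
  have s := sqrt_ne_zero h0
  have t := sqrt_I_ne_zero
  have n1 := eta_ne_zero' hz
  have n4 := eta_four_ne hz
  rw [fourQuot, fourQuot, e, eta_neg_one_div hz, eta_inv_four hz]
  field_simp

/-- The Fricke involution on `psiQuot`. -/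
theorem psiQuot_fricke {z : ℂ} (hz : 0 < z.im) :
    psiQuot z = (Complex.sqrt Complex.I)⁻¹ * (Complex.sqrt (2 : ℝ))⁻¹ *
      Complex.sqrt (-1 / z) * psiQuot (-1 / (4 * z)) := by
  have h0 := ne_zero_of_im_pos hz
  have e : 4 * (-1 / (4 * z)) = -1 / z := by field_simp
  have e2 : 2 * (-1 / (4 * z)) = -1 / (2 * z) := by field_simp; norm_num
  have s := sqrt_ne_zero h0
  have t := sqrt_I_ne_zero
  have n1 := eta_ne_zero' hz
  have n2 := eta_two_ne hz
  have n4 := eta_four_ne hz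
  have hs := sqrt_neg_one_div_mul hz
  have hI := sqrt_mul_self Complex.I
  have r := sqrt_two_ne_zero
  have r2 := sqrt_two_mul_self
  rw [psiQuot, psiQuot, e, e2, eta_neg_one_div hz, eta_inv_four hz, eta_inv_two hz]
  generalize Complex.sqrt (-1 / z) = x at *
  generalize Complex.sqrt z = y at *
  generalize Complex.sqrt Complex.I = u at *
  generalize Complex.sqrt ((2 : ℝ) : ℂ) = v at *
  generalize eta (2 * z) = η₂ at *
  generalize eta (4 * z) = η₄ at *
  field_simp
  linear_combination (u ^ 2) * r2 + 2 * hI - 2 * hs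

theorem im_mul_add_one_div_pos {z : ℂ} (hz : 0 < z.im) (m : ℝ) :
    0 < (z / (m * z + 1)).im := by
  have h0 := ne_zero_of_im_pos hz
  have h1 : 0 < (-1 / z - m).im := by rw [im_sub_ofReal]; exact im_neg_one_div_pos hz
  have h2 := im_neg_one_div_pos h1
  have h3 := ne_zero_of_im_pos h1
  have h4 : (m * z + 1 : ℂ) = -z * (-1 / z - m) := by field_simp; ring
  have h5 : z / (m * z + 1) = -1 / (-1 / z - m) := by
    rw [h4]; field_simp
  rwa [h5]

theorem mul_add_one_ne_zero {z : ℂ} (hz : 0 < z.im) (m : ℝ) : (m * z + 1 : ℂ) ≠ 0 := fun h => by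
  have := im_mul_add_one_div_pos hz m
  rw [h, div_zero] at this
  simp at this

/-- The Fricke map conjugates this substitution to translation by -n. It also inverts `fourQuot` up
to a constant, so the multiplier is that of translation by +n. -/
theorem fourQuot_lower {z : ℂ} (hz : 0 < z.im) (n : ℤ) :
    fourQuot (z / ((4 * n : ℝ) * z + 1)) = rou (6 * n) * fourQuot z := by
  have h0 := ne_zero_of_im_pos hz
  have hv := im_mul_add_one_div_pos hz (4 * n)
  have hm := mul_add_one_ne_zero hz (4 * n)
  push_cast at hv hm ⊢
  have e : -1 / (4 * (z / (4 * n * z + 1))) = -1 / (4 * z) + ((-n : ℤ) : ℂ) := by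
    push_cast; field_simp; ring
  rw [fourQuot_fricke hv, e, fourQuot_add_int, fourQuot_fricke hz, mul_neg, rou_neg]
  have := rou_ne_zero (6 * n)
  have := fourQuot_ne_zero (im_inv_four_pos hz)
  field_simp

/-- The same conjugation, but Fricke preserves `psiQuot` up to its weight factor, so the multiplier
is that of translation by -n. -/
theorem psiQuot_lower {z : ℂ} (hz : 0 < z.im) (n : ℤ) :
    psiQuot (z / ((4 * n : ℝ) * z + 1)) =
      rou (-(6 * n)) * Complex.sqrt ((4 * n : ℝ) * z + 1) * psiQuot z := by
  have h0 := ne_zero_of_im_pos hz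
  have hv := im_mul_add_one_div_pos hz (4 * n)
  have hm := mul_add_one_ne_zero hz (4 * n)
  have hw := sqrt_ne_zero (ne_zero_of_im_pos (im_neg_one_div_pos hz))
  rw [sqrt_one_add_mul hz]
  push_cast at hv hm ⊢
  have e : -1 / (4 * (z / (4 * n * z + 1))) = -1 / (4 * z) + ((-n : ℤ) : ℂ) := by
    push_cast; field_simp; ring
  have e' : -1 / (z / (4 * n * z + 1)) = -1 / z - 4 * n := by
    field_simp; ring
  rw [psiQuot_fricke hv, e, e', psiQuot_add_int, psiQuot_fricke hz, mul_neg]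
  generalize Complex.sqrt (-1 / z) = x at *
  field_simp

theorem eta_sub_half {z : ℂ} (hz : 0 < z.im) :
    eta (z - 1 / 2) = rou (-1) * eta (2 * z) ^ 3 / (eta z * eta (4 * z)) := by
  rw [show z - 1 / 2 = z + 1 / 2 + ((-1 : ℤ) : ℂ) by push_cast; ring, eta_add_int, eta_add_half hz,
    show (-1 : ℤ) = 2 * -1 + 1 by norm_num, rou_add]
  norm_num; ring

/-- In the Fricke coordinate this is translation by -1/2, so `eta_sub_half` applies and the shape of
the quotient changes. -/
theorem fourQuot_lower_two {z : ℂ} (hz : 0 < z.im) :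
    fourQuot (z / (2 * z + 1)) = rou 3 / Complex.sqrt (2 : ℝ) * fourQuotHalf z := by
  have h0 := ne_zero_of_im_pos hz
  have hv := im_mul_add_one_div_pos hz 2
  have hm := mul_add_one_ne_zero hz 2
  push_cast at hv hm
  have hu := im_inv_four_pos hz
  have e : -1 / (4 * (z / (2 * z + 1))) = -1 / (4 * z) - 1 / 2 := by
    field_simp; ring
  have e4 : 4 * (-1 / (4 * z) - 1 / 2) = -1 / z + ((-2 : ℤ) : ℂ) := by push_cast; field_simp; ring
  have e2 : 2 * (-1 / (4 * z)) = -1 / (2 * z) := by field_simp; norm_num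
  have e1 : 4 * (-1 / (4 * z)) = -1 / z := by field_simp
  rw [fourQuot_fricke hv, e, fourQuot, e4, eta_add_int, eta_sub_half hu, e1, e2, eta_neg_one_div hz,
    eta_inv_four hz, eta_inv_two hz, fourQuotHalf]
  have hr : rou 3 = rou (-1) / rou (2 * -2) := by rw [← rou_sub]; norm_num
  rw [hr]
  have s := sqrt_ne_zero h0
  have t := sqrt_I_ne_zero
  have n1 := eta_ne_zero' hz
  have n2 := eta_two_ne hz
  have n4 := eta_four_ne hz
  have r := sqrt_two_ne_zero
  have r2 := sqrt_two_mul_self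
  have := rou_ne_zero (2 * -2)
  have := rou_ne_zero (-1)
  generalize Complex.sqrt z = y at *
  generalize Complex.sqrt Complex.I = u at *
  generalize Complex.sqrt ((2 : ℝ) : ℂ) = v at *
  have r4 : v ^ 4 = 4 := by linear_combination (v * v + 2) * r2
  field_simp
  rw [r4]; norm_num

theorem psiQuot_lower_two {z : ℂ} (hz : 0 < z.im) :
    psiQuot (z / (2 * z + 1)) =
      rou (-3) / Complex.sqrt (2 : ℝ) * Complex.sqrt (2 * z + 1) * psiQuotHalf z := by
  have h0 := ne_zero_of_im_pos hz
  have hv := im_mul_add_one_div_pos hz 2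
  have hm := mul_add_one_ne_zero hz 2
  have hw := sqrt_ne_zero (ne_zero_of_im_pos (im_neg_one_div_pos hz))
  have hs1 := sqrt_one_add_mul hz 2
  push_cast at hv hm hs1
  have hu := im_inv_four_pos hz
  have e : -1 / (4 * (z / (2 * z + 1))) = -1 / (4 * z) - 1 / 2 := by
    field_simp; ring
  have e' : -1 / (z / (2 * z + 1)) = -1 / z - 2 := by
    field_simp; ring
  have e4 : 4 * (-1 / (4 * z) - 1 / 2) = -1 / z + ((-2 : ℤ) : ℂ) := by push_cast; field_simp; ring
  have e3 : 2 * (-1 / (4 * z) - 1 / 2) = -1 / (2 * z) + ((-1 : ℤ) : ℂ) := by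
    push_cast; field_simp; ring
  have e2 : 2 * (-1 / (4 * z)) = -1 / (2 * z) := by field_simp; norm_num
  have e1 : 4 * (-1 / (4 * z)) = -1 / z := by field_simp
  rw [psiQuot_fricke hv, e, e', psiQuot, e4, e3, eta_add_int, eta_add_int, eta_sub_half hu, e1, e2,
    eta_neg_one_div hz, eta_inv_four hz, eta_inv_two hz, psiQuotHalf, hs1]
  have hr : rou (-3) = rou (-1) * rou (2 * -2) / rou (2 * -1) := by
    rw [← rou_add, ← rou_sub]; norm_num
  rw [hr]
  have hs := sqrt_neg_one_div_mul hz
  have hI := sqrt_mul_self Complex.I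
  have s := sqrt_ne_zero h0
  have t := sqrt_I_ne_zero
  have n1 := eta_ne_zero' hz
  have n2 := eta_two_ne hz
  have n4 := eta_four_ne hz
  have r := sqrt_two_ne_zero
  have r2 := sqrt_two_mul_self
  have := rou_ne_zero (2 * -2)
  have := rou_ne_zero (-1)
  have := rou_ne_zero (2 * -1)
  generalize Complex.sqrt (-1 / z) = x at *
  generalize Complex.sqrt z = y at *
  generalize Complex.sqrt Complex.I = u at *
  generalize Complex.sqrt ((2 : ℝ) : ℂ) = v at *
  generalize eta (2 * z) = η₂ at *
  generalize eta (4 * z) = η₄ at *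
  generalize Complex.sqrt (-1 / z - 2) = p
  field_simp
  linear_combination p * x * y * r2 + 2 * p * hs - 2 * p * hI

/-! ### Möbius transformations with integral entries -/

/-- The Möbius transformation of the matrix with rows `(a, b)`, `(c, d)`. -/
noncomputable def mob (a b c d : ℤ) (z : ℂ) : ℂ := (a * z + b) / (c * z + d)

theorem mob_denom_ne_zero {a b c d : ℤ} (h : a * d - b * c = 1) {z : ℂ} (hz : 0 < z.im) :
    (c * z + d : ℂ) ≠ 0 := by
  intro h0
  have hi := congrArg Complex.im h0
  simp at hi
  rcases hi with hc | hz0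
  · subst hc
    simp at h0
    subst h0
    simp at h
  · exact hz.ne' hz0

theorem im_mob_pos {a b c d : ℤ} (h : a * d - b * c = 1) {z : ℂ} (hz : 0 < z.im) :
    0 < (mob a b c d z).im := by
  have h0 := mob_denom_ne_zero h hz
  have hn : 0 < Complex.normSq (c * z + d) := Complex.normSq_pos.2 h0
  have hR : (a * d - b * c : ℝ) = 1 := by exact_mod_cast h
  rw [mob, Complex.div_im]
  have : (a * z + b : ℂ).im * (c * z + d : ℂ).re / Complex.normSq (c * z + d)
      - (a * z + b : ℂ).re * (c * z + d : ℂ).im / Complex.normSq (c * z + d)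
      = z.im / Complex.normSq (c * z + d) := by
    rw [← sub_div]; congr 1; simp
    linear_combination z.im * hR
  rw [this]
  exact div_pos hz hn

theorem mob_neg (a b c d : ℤ) (z : ℂ) : mob (-a) (-b) (-c) (-d) z = mob a b c d z := by
  rw [mob, mob, ← neg_div_neg_eq]; push_cast; congr 1 <;> ring

theorem mob_add_int (a b c d n : ℤ) (z : ℂ) :
    mob a (b + n * a) c (d + n * c) z = mob a b c d (z + n) := by
  rw [mob, mob]; push_cast; congr 1 <;> ring

theorem mob_lower (a b c d n : ℤ) {z : ℂ} (hz : ((n : ℝ) * z + 1 : ℂ) ≠ 0) :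
    mob (a + n * b) b (c + n * d) d z = mob a b c d (z / ((n : ℝ) * z + 1)) := by
  push_cast at hz
  rw [mob, mob, ← mul_div_mul_right (a * _ + b : ℂ) _ hz]
  push_cast; congr 1 <;> field_simp <;> ring

theorem mob_S (a b c d : ℤ) {z : ℂ} (hz : z ≠ 0) :
    mob b (-a) d (-c) z = mob a b c d (-1 / z) := by
  rw [mob, mob, ← mul_div_mul_right (a * _ + b : ℂ) _ hz]
  push_cast; congr 1 <;> field_simp <;> ring

/-- Conjugation by diag(m, 1); it reduces the law of η(mz) to that of η. -/
theorem mul_mob (m a b c d : ℤ) (z : ℂ) :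
    m * mob a b (m * c) d z = mob a (m * b) c d (m * z) := by
  rw [mob, mob]; push_cast; rw [← mul_div_assoc]; congr 1 <;> ring

/-! ### Induction along generators -/

theorem abs_sub_or_add_lt {x y : ℤ} (hy : y ≠ 0) (h : |y| < 2 * |x|) :
    |x - y| < |x| ∨ |x + y| < |x| := by
  rcases abs_cases x with ⟨h1, _⟩ | ⟨h1, _⟩ <;> rcases abs_cases y with ⟨h2, _⟩ | ⟨h2, _⟩ <;>
    rw [abs_lt, abs_lt] <;> rw [h1, h2] at h <;> rw [h1] <;> omega

/-- Induction over `Γ₀(4)`, written as matrices with rows `(a, b)`, `(4c, d)`. -/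
theorem gammaZeroFour_induction {P : ℤ → ℤ → ℤ → ℤ → Prop}
    (one : P 1 0 0 1) (neg : ∀ a b c d, a * d - 4 * (b * c) = 1 → P a b c d → P (-a) (-b) (-c) (-d))
    (upper : ∀ a b c d, a * d - 4 * (b * c) = 1 → P a b c d → P a (b + a) c (d + 4 * c))
    (upper' : ∀ a b c d, a * d - 4 * (b * c) = 1 → P a b c d → P a (b - a) c (d - 4 * c))
    (lower : ∀ a b c d, a * d - 4 * (b * c) = 1 → P a b c d → P (a + 4 * b) b (c + d) d)
    (lower' : ∀ a b c d, a * d - 4 * (b * c) = 1 → P a b c d → P (a - 4 * b) b (c - d) d) :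
    ∀ a b c d, a * d - 4 * (b * c) = 1 → P a b c d := by
  have base : ∀ b : ℤ, P 1 b 0 1 := by
    intro b
    induction b using Int.induction_on with
    | zero => exact one
    | succ n ih => simpa using upper 1 n 0 1 (by ring) ih
    | pred n ih => simpa using upper' 1 (-n) 0 1 (by ring) ih
  -- Euclidean descent. If |d| < 2|c|, adding ±d shrinks c; otherwise |d| > 2|c|, because d is odd,
  -- and adding ±4c shrinks d.
  suffices H : ∀ n : ℕ, ∀ a b c d : ℤ, a * d - 4 * (b * c) = 1 → |c| + |d| ≤ n → P a b c d from
    fun a b c d h => H (|c| + |d|).toNat a b c d h (by omega)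
  intro n
  induction n with
  | zero =>
    intro a b c d h hn
    have hc : c = 0 := abs_eq_zero.1 (by have := abs_nonneg c; have := abs_nonneg d; omega)
    have hd : d = 0 := abs_eq_zero.1 (by have := abs_nonneg c; have := abs_nonneg d; omega)
    simp [hc, hd] at h
  | succ n ih =>
    intro a b c d h hn
    rcases eq_or_ne c 0 with rfl | hc
    · have h' : a * d = 1 := by linarith
      rcases Int.mul_eq_one_iff_eq_one_or_neg_one.1 h' with ⟨rfl, rfl⟩ | ⟨rfl, rfl⟩
      · exact base b
      · simpa using neg 1 (-b) 0 1 (by ring) (base (-b))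
    have hd : d ≠ 0 := by
      rintro rfl
      have : (4 : ℤ) ∣ 1 := ⟨-(b * c), by linarith⟩
      omega
    have hcp := abs_pos.2 hc
    rcases lt_or_ge |d| (2 * |c|) with hlt | hge
    · rcases abs_sub_or_add_lt hd hlt with hl | hl
      · have := lower (a - 4 * b) b (c - d) d (by linear_combination h)
          (ih _ _ _ _ (by linear_combination h) (by omega))
        simpa using this
      · have := lower' (a + 4 * b) b (c + d) d (by linear_combination h)
          (ih _ _ _ _ (by linear_combination h) (by omega))
        simpa using this
    · have hodd : d % 2 = 1 := by
        rcases Int.emod_two_eq_zero_or_one d with h0 | h1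
        · obtain ⟨e, rfl⟩ := Int.dvd_of_emod_eq_zero h0
          have : (2 : ℤ) ∣ 1 := ⟨a * e - 2 * (b * c), by linarith⟩
          omega
        · exact h1
      have hlt : |4 * c| < 2 * |d| := by
        rw [abs_mul, abs_of_pos (by norm_num : (0 : ℤ) < 4)]
        rcases abs_cases c with ⟨h1, _⟩ | ⟨h1, _⟩ <;> rcases abs_cases d with ⟨h2, _⟩ | ⟨h2, _⟩ <;>
          rw [h1, h2] at hge ⊢ <;> omega
      rcases abs_sub_or_add_lt (mul_ne_zero four_ne_zero hc) hlt with hl | hl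
      · have := upper a (b - a) c (d - 4 * c) (by linear_combination h)
          (ih _ _ _ _ (by linear_combination h) (by omega))
        simpa using this
      · have := upper' a (b + a) c (d + 4 * c) (by linear_combination h)
          (ih _ _ _ _ (by linear_combination h) (by omega))
        simpa using this

/-- Induction over `SL₂(ℤ)`. -/
theorem slTwo_induction {P : ℤ → ℤ → ℤ → ℤ → Prop}
    (one : P 1 0 0 1)
    (upper : ∀ a b c d, a * d - b * c = 1 → P a b c d → P a (b + a) c (d + c))
    (upper' : ∀ a b c d, a * d - b * c = 1 → P a b c d → P a (b - a) c (d - c))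
    (swap : ∀ a b c d, a * d - b * c = 1 → P a b c d → P b (-a) d (-c)) :
    ∀ a b c d, a * d - b * c = 1 → P a b c d := by
  have neg : ∀ a b c d, a * d - b * c = 1 → P a b c d → P (-a) (-b) (-c) (-d) :=
    fun a b c d h hp => swap _ _ _ _ (by linear_combination h) (swap _ _ _ _ h hp)
  have base : ∀ b : ℤ, P 1 b 0 1 := by
    intro b
    induction b using Int.induction_on with
    | zero => exact one
    | succ n ih => simpa using upper 1 n 0 1 (by ring) ih
    | pred n ih => simpa using upper' 1 (-n) 0 1 (by ring) ih
  -- The weight 2 on |c| makes the measure drop when c and d are swapped in the case |d| < |c|.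
  suffices H : ∀ n : ℕ, ∀ a b c d : ℤ, a * d - b * c = 1 → 2 * |c| + |d| ≤ n → P a b c d from
    fun a b c d h => H (2 * |c| + |d|).toNat a b c d h (by omega)
  intro n
  induction n with
  | zero =>
    intro a b c d h hn
    have hc : c = 0 := abs_eq_zero.1 (by have := abs_nonneg c; have := abs_nonneg d; omega)
    have hd : d = 0 := abs_eq_zero.1 (by have := abs_nonneg c; have := abs_nonneg d; omega)
    simp [hc, hd] at h
  | succ n ih =>
    intro a b c d h hn
    rcases eq_or_ne c 0 with rfl | hc
    · have h' : a * d = 1 := by linarith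
      rcases Int.mul_eq_one_iff_eq_one_or_neg_one.1 h' with ⟨rfl, rfl⟩ | ⟨rfl, rfl⟩
      · exact base b
      · simpa using neg 1 (-b) 0 1 (by ring) (base (-b))
    have hcp := abs_pos.2 hc
    rcases lt_or_ge |d| |c| with hlt | hge
    · have h1 := ih b (-a) d (-c) (by linear_combination h) (by rw [abs_neg]; omega)
      have h2 := neg _ _ _ _ (by linear_combination h) (swap _ _ _ _ (by linear_combination h) h1)
      simpa using h2
    · rcases abs_sub_or_add_lt hc (by omega : |c| < 2 * |d|) with hl | hl
      · have := upper a (b - a) c (d - c) (by linear_combination h)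
          (ih _ _ _ _ (by linear_combination h) (by omega))
        simpa using this
      · have := upper' a (b + a) c (d + c) (by linear_combination h)
          (ih _ _ _ _ (by linear_combination h) (by omega))
        simpa using this

/-! ### The multiplier of `η²` -/

/-- The character of `SL₂(ℤ)` of order `12`, as an exponent modulo `12`. -/
def etaSqExp {R : Type*} [CommRing R] (a b c d : R) : R :=
  (1 - c ^ 2) * (b * d + 3 * (c - 1) * d + c + 3) + c * (a + d - 3)

theorem etaSqExp_cast {R : Type*} [CommRing R] (a b c d : ℤ) :
    ((etaSqExp a b c d : ℤ) : R) = etaSqExp (a : R) (b : R) (c : R) (d : R) := by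
  simp [etaSqExp]

theorem dvd_twelve_of_cast {x : ℤ} (h3 : (x : ZMod 3) = 0) (h4 : (x : ZMod 4) = 0) : 12 ∣ x := by
  have h3' := (ZMod.intCast_zmod_eq_zero_iff_dvd x 3).1 h3
  have h4' := (ZMod.intCast_zmod_eq_zero_iff_dvd x 4).1 h4
  omega

/-- The exponent is an integral polynomial, so the congruence splits into exhaustive checks modulo 3
and modulo 4. -/
theorem etaSqExp_upper {a b c d : ℤ} (h : a * d - b * c = 1) :
    12 ∣ etaSqExp a (b + a) c (d + c) - (etaSqExp a b c d + 1) := by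
  have key3 : ∀ a b c d : ZMod 3, a * d - b * c = 1 →
      etaSqExp a (b + a) c (d + c) - (etaSqExp a b c d + 1) = 0 := by
    unfold etaSqExp; decide
  have key4 : ∀ a b c d : ZMod 4, a * d - b * c = 1 →
      etaSqExp a (b + a) c (d + c) - (etaSqExp a b c d + 1) = 0 := by
    unfold etaSqExp; decide
  apply dvd_twelve_of_cast <;> push_cast [etaSqExp_cast]
  · exact key3 _ _ _ _ (by exact_mod_cast congrArg (Int.cast (R := ZMod 3)) h)
  · exact key4 _ _ _ _ (by exact_mod_cast congrArg (Int.cast (R := ZMod 4)) h)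

theorem etaSqExp_swap {a b c d : ℤ} (h : a * d - b * c = 1) :
    12 ∣ etaSqExp b (-a) d (-c) - (etaSqExp a b c d - 3) := by
  have key3 : ∀ a b c d : ZMod 3, a * d - b * c = 1 →
      etaSqExp b (-a) d (-c) - (etaSqExp a b c d - 3) = 0 := by
    unfold etaSqExp; decide
  have key4 : ∀ a b c d : ZMod 4, a * d - b * c = 1 →
      etaSqExp b (-a) d (-c) - (etaSqExp a b c d - 3) = 0 := by
    unfold etaSqExp; decide
  apply dvd_twelve_of_cast <;> push_cast [etaSqExp_cast]
  · exact key3 _ _ _ _ (by exact_mod_cast congrArg (Int.cast (R := ZMod 3)) h)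
  · exact key4 _ _ _ _ (by exact_mod_cast congrArg (Int.cast (R := ZMod 4)) h)

theorem eta_sq_add_int (z : ℂ) (n : ℤ) : eta (z + n) ^ 2 = rou (4 * n) * eta z ^ 2 := by
  rw [eta_add_int, mul_pow, ← rou_mul_nat]; congr 2; push_cast; ring

theorem eta_sq_neg_one_div {z : ℂ} (hz : 0 < z.im) :
    eta (-1 / z) ^ 2 = rou (-12) * z * eta z ^ 2 := by
  have h1 := sqrt_mul_self z
  have h2 := sqrt_mul_self Complex.I
  rw [eta_neg_one_div hz, rou_neg, rou_12, mul_pow, mul_pow, inv_pow, pow_two, h2, pow_two, h1]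
  ring

/-- Squaring removes the square root from the automorphy factor, so the multiplier composes without
branch choices and translation and inversion suffice. -/
theorem eta_sq_mob {a b c d : ℤ} (h : a * d - b * c = 1) {z : ℂ} (hz : 0 < z.im) :
    eta (mob a b c d z) ^ 2 = rou (4 * etaSqExp a b c d) * (c * z + d) * eta z ^ 2 := by
  revert z
  refine slTwo_induction (P := fun a b c d => ∀ {z : ℂ}, 0 < z.im →
    eta (mob a b c d z) ^ 2 = rou (4 * etaSqExp a b c d) * (c * z + d) * eta z ^ 2)
    ?_ ?_ ?_ ?_ a b c d h
  · intro z _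
    simp [mob, etaSqExp, rou_zero]
  · intro a b c d h ih z hz
    have h1 := mob_add_int a b c d 1 z
    have h2 := eta_sq_add_int z 1
    have h3 := ih (z := z + (1 : ℤ)) (by simpa using hz)
    have h4 : rou (4 * etaSqExp a (b + a) c (d + c)) = rou (4 * etaSqExp a b c d) * rou 4 := by
      rw [← rou_add]; apply rou_congr
      have := etaSqExp_upper h; omega
    rw [one_mul, one_mul] at h1
    rw [h1, h3, h2, h4]; push_cast; ring
  · intro a b c d h ih z hz
    have h1 := mob_add_int a b c d (-1) z
    have h2 := eta_sq_add_int z (-1)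
    have h3 := ih (z := z + (-1 : ℤ)) (by simpa using hz)
    have h4 : rou (4 * etaSqExp a (b - a) c (d - c)) = rou (4 * etaSqExp a b c d) * rou (4 * -1) := by
      rw [← rou_add]; apply rou_congr
      have := etaSqExp_upper (a := a) (b := b - a) (c := c) (d := d - c) (by linear_combination h)
      rw [sub_add_cancel, sub_add_cancel] at this
      omega
    rw [neg_one_mul, neg_one_mul, ← sub_eq_add_neg, ← sub_eq_add_neg] at h1
    rw [h1, h3, h2, h4]; push_cast; ring
  · intro a b c d h ih z hz
    have h0 := ne_zero_of_im_pos hz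
    have h4 : rou (4 * etaSqExp b (-a) d (-c)) = rou (4 * etaSqExp a b c d) * rou (-12) := by
      rw [← rou_add]; apply rou_congr
      have := etaSqExp_swap h; omega
    rw [mob_S a b c d h0, ih (im_neg_one_div_pos hz), eta_sq_neg_one_div hz, h4]
    push_cast; field_simp; ring

/-! ### The multiplier of `fourQuot` -/

theorem odd_left_of_det {a b c d : ℤ} (h : a * d - 4 * (b * c) = 1) : Odd a := by
  have : Odd (a * d) := ⟨2 * (b * c), by linear_combination h⟩
  exact (Int.odd_mul.1 this).1

theorem odd_right_of_det {a b c d : ℤ} (h : a * d - 4 * (b * c) = 1) : Odd d :=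
  odd_left_of_det (a := d) (d := a) (b := b) (c := c) (by linear_combination h)

theorem even_mul_add_of_odd {a : ℤ} (h : Odd a) (c : ℤ) : Even (c * (a + c)) := by
  rcases Int.even_or_odd c with hc | hc
  · exact hc.mul_right _
  · exact (h.add_odd hc).mul_left _

theorem eight_dvd_sq_sub_one {d : ℤ} (h : Odd d) : 8 ∣ d ^ 2 - 1 := Int.eight_dvd_sq_sub_one_of_odd h

theorem fourQuot_exp_upper {a b c d : ℤ} (h : a * d - 4 * (b * c) = 1) :
    8 ∣ (b + a + c) * (d + 4 * c) - ((b + c) * d + 1) := by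
  obtain ⟨k, hk⟩ := even_mul_add_of_odd (odd_left_of_det h) c
  exact ⟨b * c + k, by linear_combination h + 4 * hk⟩

/-- In weight 0 the multiplier is a character, and both unipotent generators have value `rou 6`. The
exponent follows suit modulo 8 because a and d are odd. -/
theorem fourQuot_mob_gammaZeroFour {a b c d : ℤ} (h : a * d - 4 * (b * c) = 1) {z : ℂ}
    (hz : 0 < z.im) :
    fourQuot (mob a b (4 * c) d z) = rou (6 * ((b + c) * d)) * fourQuot z := by
  have upper : ∀ a b c d : ℤ, a * d - 4 * (b * c) = 1 →
      rou (6 * ((b + a + c) * (d + 4 * c))) = rou (6 * ((b + c) * d)) * rou 6 := by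
    intro a b c d h
    rw [← rou_add]; apply rou_congr
    have := fourQuot_exp_upper h; omega
  have lower : ∀ a b c d : ℤ, a * d - 4 * (b * c) = 1 →
      rou (6 * ((b + (c + d)) * d)) = rou (6 * ((b + c) * d)) * rou 6 := by
    intro a b c d h
    rw [← rou_add]; apply rou_congr
    have := eight_dvd_sq_sub_one (odd_right_of_det h)
    have e : (b + (c + d)) * d = (b + c) * d + d ^ 2 := by ring
    omega
  refine gammaZeroFour_induction (P := fun a b c d => ∀ z : ℂ, 0 < z.im →
    fourQuot (mob a b (4 * c) d z) = rou (6 * ((b + c) * d)) * fourQuot z)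
    ?_ ?_ ?_ ?_ ?_ ?_ a b c d h z hz
  · intro z _
    simp [mob, rou_zero]
  · intro a b c d h ih z hz
    rw [mul_neg, mob_neg, ih z hz]
    congr 2; ring
  · intro a b c d h ih z hz
    have h1 := mob_add_int a b (4 * c) d 1 z
    rw [one_mul, one_mul] at h1
    rw [h1, ih _ (by simpa using hz), fourQuot_add_int, upper a b c d h]
    norm_num; ring
  · intro a b c d h ih z hz
    have h1 := mob_add_int a b (4 * c) d (-1) z
    rw [neg_one_mul, neg_one_mul, ← sub_eq_add_neg, ← sub_eq_add_neg] at h1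
    have h2 := upper a (b - a) c (d - 4 * c) (by linear_combination h)
    rw [sub_add_cancel, sub_add_cancel] at h2
    rw [h1, ih _ (by simpa using hz), fourQuot_add_int, h2, mul_neg, rou_neg, mul_one]
    field_simp [rou_ne_zero]
  · intro a b c d h ih z hz
    have h1 := mob_lower a b (4 * c) d 4 (mul_add_one_ne_zero hz (4 : ℤ))
    have h3 := fourQuot_lower hz 1
    have h4 := im_mul_add_one_div_pos hz (4 : ℤ)
    rw [← mul_add] at h1
    rw [h1, ih _ h4]
    norm_num at h3 ⊢
    rw [h3, lower a b c d h]; ring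
  · intro a b c d h ih z hz
    have h1 := mob_lower a b (4 * c) d (-4) (mul_add_one_ne_zero hz (-4 : ℤ))
    have h3 := fourQuot_lower hz (-1)
    have h4 := im_mul_add_one_div_pos hz (-4 : ℤ)
    have h2 := lower (a - 4 * b) b (c - d) d (by linear_combination h)
    rw [sub_add_cancel] at h2
    rw [neg_mul, neg_mul, ← sub_eq_add_neg, ← sub_eq_add_neg, ← mul_sub] at h1
    rw [h1, ih _ h4, h2]
    norm_num at h3 ⊢
    rw [h3, rou_neg]
    field_simp [rou_ne_zero]

/-- The condition on c says that the matrix is (a-2b, b; 4e, d) times (1 0; 2 1), the coset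
belonging to the cusp 1/2. -/
theorem mob_lower_two {a b c d e : ℤ} (he : c = 4 * e + 2 * d) {z : ℂ} (hz : 0 < z.im) :
    mob a b c d z = mob (a - 2 * b) b (4 * e) d (z / (2 * z + 1)) := by
  have h := mob_lower (a - 2 * b) b (4 * e) d 2 (mul_add_one_ne_zero hz (2 : ℤ))
  rw [sub_add_cancel, ← he] at h
  simpa using h

theorem im_div_two_mul_add_one_pos {z : ℂ} (hz : 0 < z.im) : 0 < (z / (2 * z + 1)).im := by
  simpa using im_mul_add_one_div_pos hz 2

theorem fourQuot_mob {a b c d e : ℤ} (h : a * d - b * c = 1) (he : c = 4 * e + 2 * d) {z : ℂ}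
    (hz : 0 < z.im) :
    fourQuot (mob a b c d z) =
      rou (6 * ((b + e) * d) + 3) / Complex.sqrt (2 : ℝ) * fourQuotHalf z := by
  rw [mob_lower_two he hz, fourQuot_mob_gammaZeroFour (by rw [he] at h; linear_combination h)
    (im_div_two_mul_add_one_pos hz), fourQuot_lower_two hz, rou_add]
  ring

/-! ### The multiplier of `psiQuot` -/

/-- 4a ≡ 1 modulo 4a-1, and 4 is a square. -/
theorem jacobiSym_four_mul_sub_one {a : ℕ} (ha : 0 < a) : jacobiSym a (4 * a - 1) = 1 := by
  have hodd : Odd (4 * a - 1) := ⟨2 * a - 1, by omega⟩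
  have h2 : jacobiSym (2 ^ 2 : ℤ) (4 * a - 1) = 1 := by
    refine jacobiSym.sq_one' ?_
    exact (Nat.coprime_two_left.2 hodd : Nat.Coprime 2 (4 * a - 1))
  have h4 : jacobiSym ((2 ^ 2 : ℤ) * a) (4 * a - 1) = 1 := by
    rw [jacobiSym.mod_left' (a₂ := 1), jacobiSym.one_left]
    refine (Int.ModEq.symm (Int.modEq_iff_dvd.2 ⟨1, ?_⟩) : (2 ^ 2 : ℤ) * a ≡ 1 [ZMOD _])
    push_cast [show 1 ≤ 4 * a by omega]; ring
  rwa [jacobiSym.mul_left, h2, one_mul] at h4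

/-- Reflection of the Jacobi symbol `(a | ·)` for positive `a`. -/
theorem jacobiSym_reflect {a b b' : ℕ} (hb : Odd b) (hab : Nat.Coprime a b) (h : b + b' = 4 * a) :
    jacobiSym a b' = jacobiSym a b := by
  have ha : 0 < a := by
    rcases Nat.eq_zero_or_pos a with rfl | h0
    · have := hb.pos; omega
    · exact h0
  have hb' : Odd b' := by
    rcases Nat.even_or_odd b' with he | ho
    · exfalso
      have : Odd (b + b') := hb.add_even he
      rw [h] at this
      exact Nat.not_odd_iff_even.2 ⟨2 * a, by ring⟩ this
    · exact ho
  have hodd : Odd (4 * a - 1) := ⟨2 * a - 1, by omega⟩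
  have hsq : jacobiSym a b * jacobiSym a b = 1 := by
    rw [← pow_two]; exact jacobiSym.sq_one hab
  -- Since b' ≡ -b mod 4a, bb' ≡ b²(4a-1), and the symbol of a depends on its odd denominator only
  -- modulo 4a.
  have key : jacobiSym a (b * b') = 1 := by
    have e1 := jacobiSym.mod_right' a (hb.mul hb')
    have e2 := jacobiSym.mod_right' a ((hb.mul hb).mul hodd)
    have e3 : b * b' % (4 * a) = b * b * (4 * a - 1) % (4 * a) := by
      have : Nat.ModEq (4 * a) (b * b') (b * b * (4 * a - 1)) := by
        apply Nat.ModEq.add_right_cancel' (b * b)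
        rw [← mul_add, add_comm b' b, h]
        have e : b * b * (4 * a - 1) + b * b = b * b * (4 * a) := by
          conv_rhs => rw [show 4 * a = (4 * a - 1) + 1 by omega]
          ring
        rw [e]
        exact ((Nat.modEq_zero_iff_dvd.2 ⟨b, by ring⟩).trans
          (Nat.modEq_zero_iff_dvd.2 ⟨b * b, by ring⟩).symm)
      exact this
    rw [e1, e3, ← e2, jacobiSym.mul_right' _ (Nat.mul_pos hb.pos hb.pos).ne' hodd.pos.ne',
      jacobiSym.mul_right' _ hb.pos.ne' hb.pos.ne', hsq, jacobiSym_four_mul_sub_one ha, one_mul]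
  rw [jacobiSym.mul_right' _ hb.pos.ne' hb'.pos.ne'] at key
  calc jacobiSym a b' = jacobiSym a b * jacobiSym a b * jacobiSym a b' := by rw [hsq, one_mul]
    _ = jacobiSym a b := by rw [mul_assoc, key, mul_one]

/-- The factor `1` or `-i` according to `d` modulo `4`. -/
noncomputable def oddSign (d : ℤ) : ℂ := if d % 4 = 1 then 1 else -Complex.I

/-- The Jacobi symbol `(c | d)` with a positive integer `d` as denominator. -/
noncomputable def jac (c d : ℤ) : ℂ := (jacobiSym c d.toNat : ℤ)

theorem jac_add_mul {c d n : ℤ} (hd : 0 < d) (hodd : Odd d) (hd' : 0 < d + 4 * (n * c)) :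
    jac c (d + 4 * (n * c)) = jac c d := by
  lift d to ℕ using hd.le
  obtain ⟨d', hd''⟩ := Int.eq_ofNat_of_zero_le hd'.le
  have ho : Odd d := by exact_mod_cast hodd
  have ho' : Odd d' := by
    have : Odd (d' : ℤ) := by
      rw [← hd'']; exact hodd.add_even ⟨2 * (n * c), by ring⟩
    exact_mod_cast this
  rw [hd'', jac, jac, Int.toNat_natCast, Int.toNat_natCast, jacobiSym.mod_right c ho,
    jacobiSym.mod_right c ho']
  congr 2
  have : (d' : ℤ) ≡ d [ZMOD (4 * c.natAbs : ℕ)] := by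
    apply Int.ModEq.symm
    rw [Int.modEq_iff_dvd, ← hd'']
    push_cast
    rw [add_sub_cancel_left]
    refine mul_dvd_mul_left 4 ?_
    rw [abs_dvd]; exact dvd_mul_left c n
  exact (Int.natCast_modEq_iff.1 this)

theorem jac_reflect {c d d' : ℤ} (hd : 0 < d) (hd' : 0 < d') (hodd : Odd d) (hc : 0 < c)
    (hcop : IsCoprime c d) (h : d + d' = 4 * c) : jac c d' = jac c d := by
  lift d to ℕ using hd.le
  lift d' to ℕ using hd'.le
  lift c to ℕ using hc.le
  have := jacobiSym_reflect (by exact_mod_cast hodd) (Nat.isCoprime_iff_coprime.1 hcop)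
    (by exact_mod_cast h : d + d' = 4 * c)
  simp [jac, this]

theorem jac_neg {c d : ℤ} (hd : 0 < d) (hodd : Odd d) :
    jac (-c) d = (if d % 4 = 1 then 1 else -1) * jac c d := by
  lift d to ℕ using hd.le
  have ho : Odd d := by exact_mod_cast hodd
  rw [jac, jac, Int.toNat_natCast, jacobiSym.neg _ ho, Int.cast_mul]
  congr 1
  have h2 := Nat.odd_iff.1 ho
  rcases (by omega : d % 4 = 1 ∨ d % 4 = 3) with h | h
  · rw [ZMod.χ₄_nat_one_mod_four h, if_pos (by omega)]; simp
  · rw [ZMod.χ₄_nat_three_mod_four h, if_neg (by omega)]; simp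

/-- As d' ≡ -d mod 4, `oddSign` switches between 1 and -i. The factor i, which will come from √(-w),
and the sign (-1|d) make up for this. -/
theorem jac_oddSign_reflect_neg {c d d' : ℤ} (hd : 0 < d) (hd' : 0 < d') (hodd : Odd d)
    (hc : c < 0) (hcop : IsCoprime c d) (h : d + d' = -(4 * c)) :
    jac (-c) d' * oddSign d' * Complex.I = jac c d * oddSign d := by
  have h1 := jac_reflect hd hd' hodd (neg_pos.2 hc) hcop.neg_left (by linarith)
  have h2 := jac_neg (c := -c) hd hodd
  rw [neg_neg] at h2
  rw [h1, h2, oddSign, oddSign]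
  have := Int.odd_iff.1 hodd
  rcases (by omega : d % 4 = 1 ∨ d % 4 = 3) with h3 | h3
  · rw [if_neg (by omega), if_pos h3, if_pos h3]
    linear_combination (-jac (-c) d) * Complex.I_mul_I
  · rw [if_pos (by omega), if_neg (by omega), if_neg (by omega)]
    ring

theorem jac_oddSign_reflect_pos {c d d' : ℤ} (hd : 0 < d) (hd' : 0 < d') (hodd : Odd d)
    (hc : 0 < c) (hcop : IsCoprime c d) (h : d + d' = 4 * c) :
    jac (-c) d' * oddSign d' * (-Complex.I) = jac c d * oddSign d := by
  have hodd' : Odd d' := by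
    have : Odd (4 * c - d) := Even.sub_odd ⟨2 * c, by ring⟩ hodd
    rwa [← h, add_sub_cancel_left] at this
  have h1 := jac_reflect hd hd' hodd hc hcop (by linarith)
  have h2 := jac_neg (c := c) hd' hodd'
  rw [h2, h1, oddSign, oddSign]
  have := Int.odd_iff.1 hodd
  rcases (by omega : d % 4 = 1 ∨ d % 4 = 3) with h3 | h3
  · simp only [if_neg (by omega : ¬ d' % 4 = 1), if_pos h3]
    linear_combination (-jac c d) * Complex.I_mul_I
  · simp only [if_pos (by omega : d' % 4 = 1), if_neg (by omega : ¬ d % 4 = 1)]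
    ring

/-- The transformation law of `psiQuot` under the matrix with rows `(a, b)`, `(4c, d)`. -/
def PsiLaw (a b c d : ℤ) : Prop := ∀ z : ℂ, 0 < z.im →
  psiQuot (mob a b (4 * c) d z) = jac c d * oddSign d * rou (6 * ((b - c) * d)) *
    Complex.sqrt ((4 * c : ℤ) * z + d) * psiQuot z

theorem psiQuot_exp_upper {a b c d n : ℤ} (h : a * d - 4 * (b * c) = 1) (hn : Odd n) :
    rou (6 * ((b + n * a - c) * (d + n * (4 * c)))) = rou (6 * ((b - c) * d)) * rou (6 * n) := by
  rw [← rou_add]; apply rou_congr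
  obtain ⟨k, hk⟩ := even_mul_add_of_odd (hn.mul (odd_left_of_det h)) (-c)
  refine ⟨n * (b * c) - n * k, ?_⟩
  linear_combination 6 * n * h - 24 * n * hk

theorem oddSign_add_four_mul (d c : ℤ) : oddSign (d + 4 * c) = oddSign d := by
  rw [oddSign, oddSign, show (d + 4 * c) % 4 = d % 4 by omega]

/-- Translation may make the last entry negative, where neither the symbol nor the root has the
required form. The negated matrix then takes over, and reflection of the symbol absorbs the factor
±i relating √(-w) to √w. The condition n² = 1 gives d + d' = 4|c|, as reflection needs. -/
theorem PsiLaw.upper {a b c d n : ℤ} (h : a * d - 4 * (b * c) = 1) (hn : Odd n)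
    (law : PsiLaw a b c d) (hd : 0 < d) :
    (0 < d + n * (4 * c) → PsiLaw a (b + n * a) c (d + n * (4 * c))) ∧
    (d + n * (4 * c) < 0 → n * n = 1 → PsiLaw (-a) (-(b + n * a)) (-c) (-(d + n * (4 * c)))) := by
  have hodd := odd_right_of_det h
  have hcop : IsCoprime c d := ⟨-4 * b, a, by linear_combination h⟩
  have step : ∀ z : ℂ, 0 < z.im → psiQuot (mob a (b + n * a) (4 * c) (d + n * (4 * c)) z) =
      jac c d * oddSign d * (rou (6 * ((b - c) * d)) * rou (6 * n)) *
        Complex.sqrt ((4 * c : ℤ) * z + (d + n * (4 * c) : ℤ)) * psiQuot z := by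
    intro z hz
    rw [mob_add_int, law _ (by simpa using hz), psiQuot_add_int,
      show ((4 * c : ℤ) * (z + n) + d : ℂ) = (4 * c : ℤ) * z + (d + n * (4 * c) : ℤ) by
        push_cast; ring]
    ring
  refine ⟨fun hpos z hz => ?_, fun hneg hn1 z hz => ?_⟩
  · rw [step z hz, psiQuot_exp_upper h hn]
    have e : d + n * (4 * c) = d + 4 * (n * c) := by ring
    rw [e] at hpos ⊢
    rw [jac_add_mul hd hodd hpos, oddSign_add_four_mul]
  · rw [mul_neg, mob_neg, step z hz, show (-(b + n * a) - -c) * -(d + n * (4 * c)) =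
      (b + n * a - c) * (d + n * (4 * c)) by ring, psiQuot_exp_upper h hn]
    have hnc : n * c < 0 := by linarith
    have hc0 : c ≠ 0 := by rintro rfl; simp at hnc
    have eZ : ((-(4 * c) : ℤ) * z + (-(d + n * (4 * c)) : ℤ) : ℂ) =
        -((4 * c : ℤ) * z + (d + n * (4 * c) : ℤ)) := by push_cast; ring
    have him : ((4 * c : ℤ) * z + (d + n * (4 * c) : ℤ) : ℂ).im = 4 * c * z.im := by
      push_cast
      simp
    rw [eZ]
    have hn' : n = 1 ∨ n = -1 := by
      rcases Int.mul_eq_one_iff_eq_one_or_neg_one.1 hn1 with h1 | h1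
      · exact Or.inl h1.1
      · exact Or.inr h1.1
    rcases lt_or_gt_of_ne hc0 with hc | hc
    · have hn0 : n = 1 := by
        rcases hn' with h1 | h1
        · exact h1
        · subst h1; linarith
      have key := jac_oddSign_reflect_neg (d' := -(d + n * (4 * c))) hd (by linarith) hodd hc hcop
        (by rw [hn0]; ring)
      rw [sqrt_neg_of_im_neg, ← key]
      · ring
      · rw [him]
        have : (c : ℝ) < 0 := by exact_mod_cast hc
        have := mul_neg_of_neg_of_pos this hz
        linarith
    · have hn0 : n = -1 := by
        rcases hn' with h1 | h1
        · subst h1; linarith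
        · exact h1
      have key := jac_oddSign_reflect_pos (d' := -(d + n * (4 * c))) hd (by linarith) hodd hc hcop
        (by rw [hn0]; ring)
      rw [sqrt_neg_of_im_pos, ← key]
      · ring
      · rw [him]
        have : (0 : ℝ) < c := by exact_mod_cast hc
        have := mul_pos this hz
        linarith

theorem jac_add_right {c d : ℤ} (n : ℤ) (hd : 0 < d) : jac (c + n * d) d = jac c d := by
  lift d to ℕ using hd.le
  rw [jac, jac, Int.toNat_natCast, jacobiSym.mod_left' (a₂ := c)]
  simp

theorem sqrt_cocycle_int {z : ℂ} (hz : 0 < z.im) {c d : ℤ} (m : ℤ) (hd : 0 < d) :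
    Complex.sqrt (c * (z / ((m : ℝ) * z + 1)) + d) * Complex.sqrt ((m : ℝ) * z + 1)
      = Complex.sqrt ((c + m * d : ℤ) * z + d) := by
  have := sqrt_cocycle hz (c := c) (d := d) (m := m) (by exact_mod_cast hd)
    (mul_add_one_ne_zero hz m)
  push_cast at this ⊢
  rw [this, mul_comm (d : ℂ)]

/-- Here d is unchanged and c moves by a multiple of d, so the symbol is stable and only the cocycle
of the root is at work. -/
theorem PsiLaw.lower {a b c d : ℤ} (n : ℤ) (h : a * d - 4 * (b * c) = 1)
    (law : PsiLaw a b c d) (hd : 0 < d) : PsiLaw (a + 4 * n * b) b (c + n * d) d := by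
  intro z hz
  have h1 := mob_lower a b (4 * c) d (4 * n) (mul_add_one_ne_zero hz (4 * n : ℤ))
  have h3 := psiQuot_lower hz n
  have h4 := im_mul_add_one_div_pos hz (4 * n : ℤ)
  have h5 := sqrt_cocycle_int hz (c := 4 * c) (4 * n) hd
  have h6 : rou (6 * ((b - (c + n * d)) * d)) = rou (6 * ((b - c) * d)) * rou (-(6 * n)) := by
    rw [← rou_add]; apply rou_congr
    have := eight_dvd_sq_sub_one (odd_right_of_det h)
    obtain ⟨k, hk⟩ := this
    exact ⟨-n * k, by linear_combination (-6 * n) * hk⟩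
  have e : 4 * c + 4 * n * d = 4 * (c + n * d) := by ring
  have e2 : ((4 * n : ℤ) : ℝ) = 4 * n := by push_cast; ring
  rw [e] at h1 h5
  rw [h1, law _ h4, ← h5, h6, jac_add_right n hd, e2, h3]
  ring

/-- The sign of d varies along the induction, so the claim is carried for whichever of the matrix
and its negative has positive last entry. -/
theorem psiLaw_aux : ∀ a b c d : ℤ, a * d - 4 * (b * c) = 1 →
    (0 < d → PsiLaw a b c d) ∧ (d < 0 → PsiLaw (-a) (-b) (-c) (-d)) := by
  have upperN : ∀ n : ℤ, n * n = 1 → Odd n → ∀ a b c d : ℤ, a * d - 4 * (b * c) = 1 →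
      ((0 < d → PsiLaw a b c d) ∧ (d < 0 → PsiLaw (-a) (-b) (-c) (-d))) →
      ((0 < d + n * (4 * c) → PsiLaw a (b + n * a) c (d + n * (4 * c))) ∧
       (d + n * (4 * c) < 0 → PsiLaw (-a) (-(b + n * a)) (-c) (-(d + n * (4 * c))))) := by
    intro n hn1 hn a b c d h ⟨ihp, ihn⟩
    have hd0 : d ≠ 0 := by
      rintro rfl; have := odd_right_of_det h; simp at this
    rcases lt_or_gt_of_ne hd0 with hd | hd
    · have := (ihn hd).upper (n := n) (by linear_combination h) hn (neg_pos.2 hd)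
      refine ⟨fun hp => ?_, fun hp => ?_⟩
      · have h2 := this.2 (by linarith) hn1
        convert h2 using 1 <;> ring
      · have h2 := this.1 (by linarith)
        convert h2 using 1 <;> ring
    · have := (ihp hd).upper (n := n) h hn hd
      exact ⟨this.1, fun hp => this.2 hp hn1⟩
  have lowerN : ∀ n a b c d : ℤ, a * d - 4 * (b * c) = 1 →
      ((0 < d → PsiLaw a b c d) ∧ (d < 0 → PsiLaw (-a) (-b) (-c) (-d))) →
      ((0 < d → PsiLaw (a + 4 * n * b) b (c + n * d) d) ∧
       (d < 0 → PsiLaw (-(a + 4 * n * b)) (-b) (-(c + n * d)) (-d))) := by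
    intro n a b c d h ⟨ihp, ihn⟩
    refine ⟨fun hd => (ihp hd).lower n h hd, fun hd => ?_⟩
    have h2 := (ihn hd).lower n (by linear_combination h) (neg_pos.2 hd)
    convert h2 using 1 <;> ring
  refine gammaZeroFour_induction ?_ ?_ ?_ ?_ ?_ ?_
  · refine ⟨fun _ z _ => ?_, fun h => by omega⟩
    simp [mob, jac, oddSign, rou_zero, jacobiSym.one_right]
  · intro a b c d h ih
    refine ⟨fun hd => ih.2 (by omega), fun hd => ?_⟩
    rw [neg_neg, neg_neg, neg_neg, neg_neg]
    exact ih.1 (by omega)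
  · intro a b c d h ih
    simpa using upperN 1 (by norm_num) (by decide) a b c d h ih
  · intro a b c d h ih
    have := upperN (-1) (by norm_num) (by decide) a b c d h ih
    rwa [neg_one_mul, neg_one_mul, ← sub_eq_add_neg, ← sub_eq_add_neg] at this
  · intro a b c d h ih
    simpa using lowerN 1 a b c d h ih
  · intro a b c d h ih
    have := lowerN (-1) a b c d h ih
    rwa [show a + 4 * -1 * b = a - 4 * b by ring, neg_one_mul, ← sub_eq_add_neg] at this

theorem psiLaw {a b c d : ℤ} (h : a * d - 4 * (b * c) = 1) (hd : 0 < d) : PsiLaw a b c d :=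
  (psiLaw_aux a b c d h).1 hd

theorem psiQuot_mob {a b c d e : ℤ} (h : a * d - b * c = 1) (he : c = 4 * e + 2 * d)
    (hd : 0 < d) (hd4 : d % 4 = 1) {z : ℂ} (hz : 0 < z.im) :
    psiQuot (mob a b c d z) = jac e d * rou (6 * ((b - e) * d) - 3) / Complex.sqrt (2 : ℝ) *
      Complex.sqrt (c * z + d) * psiQuotHalf z := by
  have hs := sqrt_cocycle_int hz (c := 4 * e) 2 hd
  rw [← he] at hs
  rw [← hs, mob_lower_two he hz, psiLaw (by rw [he] at h; linear_combination h) hd _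
    (im_div_two_mul_add_one_pos hz), psiQuot_lower_two hz, oddSign, if_pos hd4,
    sub_eq_add_neg _ (3 : ℤ), rou_add]
  push_cast
  ring

theorem jac_mul_left (a b : ℤ) (d : ℤ) : jac (a * b) d = jac a d * jac b d := by
  rw [jac, jacobiSym.mul_left, Int.cast_mul]; rfl

theorem jac_mul_self {a d : ℤ} (h : IsCoprime a d) (hd : 0 < d) : jac a d * jac a d = 1 := by
  lift d to ℕ using hd.le
  have := jacobiSym.sq_one (a := a) (b := d) (Int.isCoprime_iff_gcd_eq_one.1 h)
  rw [jac, Int.toNat_natCast, ← Int.cast_mul, ← pow_two, this, Int.cast_one]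

/-! ### The operator `U` as an average over translates -/

/-- `f(τ) = ∑ a(n) qⁿ` on the whole upper half-plane. -/
def HasQSeries (f : ℍ → ℂ) (a : ℤ → ℂ) : Prop :=
  ∀ τ, HasSum (fun n : ℤ => a n * nome τ ^ n) (f τ)

theorem HasQSeries.iterate_U {f : ℍ → ℂ} {a : ℤ → ℂ} (hf : HasQSeries f a) {d : ℕ} (hd : 0 < d)
    (k : ℕ) : HasQSeries ((U d)^[k] f) fun n => a (d ^ k * n) := by
  induction k with
  | zero => simpa using hf
  | succ k ih =>
    rw [Function.iterate_succ_apply']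
    intro τ
    have := hasSum_U ih hd τ
    simpa only [← mul_assoc, ← pow_succ] using this

theorem HasQSeries.eq_of_nome_eq {f : ℍ → ℂ} {a : ℤ → ℂ} (hf : HasQSeries f a) {σ τ : ℍ}
    (h : nome σ = nome τ) : f σ = f τ := by
  have h1 := hf σ
  rw [h] at h1
  exact h1.unique (hf τ)

/-- The point `(τ + j)/M`. -/
noncomputable def transDiv (M : ℕ) [NeZero M] (τ : ℍ) (j : ℤ) : ℍ :=
  ⟨((τ : ℂ) + j) / M, by
    have hM : (0 : ℝ) < M := by exact_mod_cast Nat.pos_of_ne_zero (NeZero.ne M)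
    have h : (((τ : ℂ) + j) / (M : ℂ)).im = τ.im / M := by
      rw [show (M : ℂ) = ((M : ℝ) : ℂ) by simp, Complex.div_ofReal_im]; simp
    rw [h]; exact div_pos τ.im_pos hM⟩

theorem coe_transDiv (M : ℕ) [NeZero M] (τ : ℍ) (j : ℤ) :
    (transDiv M τ j : ℂ) = ((τ : ℂ) + j) / M := rfl

theorem nome_transDiv (M : ℕ) [NeZero M] (τ : ℍ) (j : ℤ) :
    nome (transDiv M τ j) =
      nome (transDiv M τ 0) * Complex.exp (2 * Real.pi * Complex.I * (j / M)) := by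
  rw [nome, nome, coe_transDiv, coe_transDiv, ← Complex.exp_add]
  congr 1; push_cast; ring

theorem nome_transDiv_congr (M : ℕ) [NeZero M] (τ : ℍ) {i j : ℤ} (h : (i : ZMod M) = j) :
    nome (transDiv M τ i) = nome (transDiv M τ j) := by
  obtain ⟨k, hk⟩ := (ZMod.intCast_eq_intCast_iff_dvd_sub i j M).1 h
  have hM : (M : ℂ) ≠ 0 := by exact_mod_cast NeZero.ne M
  rw [nome, nome, Complex.exp_eq_exp_iff_exists_int, coe_transDiv, coe_transDiv]
  refine ⟨-k, ?_⟩
  have hj : (j : ℂ) = i + M * k := by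
    have : j = i + M * k := by linarith
    exact_mod_cast congrArg (Int.cast (R := ℂ)) this
  rw [hj]; push_cast; field_simp; ring

theorem nome_transDiv_zero_zpow (M : ℕ) [NeZero M] (τ : ℍ) (n : ℤ) :
    nome (transDiv M τ 0) ^ ((M : ℤ) * n) = nome τ ^ n := by
  have hM : (M : ℂ) ≠ 0 := by exact_mod_cast NeZero.ne M
  rw [zpow_mul]
  congr 1
  rw [nome, nome, ← Complex.exp_int_mul, coe_transDiv]
  congr 1; push_cast; field_simp; ring

theorem sum_exp_mul (M : ℕ) [NeZero M] (n : ℤ) :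
    ∑ j ∈ Finset.range M, Complex.exp (2 * Real.pi * Complex.I * ((j : ℤ) / M)) ^ n
      = if (M : ℤ) ∣ n then (M : ℂ) else 0 := by
  have hM : (M : ℂ) ≠ 0 := by exact_mod_cast NeZero.ne M
  set w := Complex.exp (2 * Real.pi * Complex.I * (n / M)) with hw
  have hj : ∀ j : ℕ, Complex.exp (2 * Real.pi * Complex.I * ((j : ℤ) / M)) ^ n = w ^ j := by
    intro j
    rw [hw, ← Complex.exp_int_mul, ← Complex.exp_nat_mul]
    congr 1; push_cast; ring
  simp_rw [hj]
  split_ifs with h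
  · obtain ⟨k, rfl⟩ := h
    have : w = 1 := by
      rw [hw, Complex.exp_eq_one_iff]
      exact ⟨k, by push_cast; field_simp⟩
    simp [this]
  · have h1 : w ≠ 1 := by
      intro h1
      rw [hw, Complex.exp_eq_one_iff] at h1
      obtain ⟨k, hk⟩ := h1
      apply h
      refine ⟨k, ?_⟩
      have h2 : (n : ℂ) / M = k := by
        have hpi : (2 * Real.pi * Complex.I : ℂ) ≠ 0 := by simp [Real.pi_ne_zero]
        apply mul_left_cancel₀ hpi
        rw [hk]; ring
      rw [div_eq_iff hM] at h2
      have : ((n : ℤ) : ℂ) = ((M * k : ℤ) : ℂ) := by rw [h2]; push_cast; ring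
      exact_mod_cast this
    have hwM : w ^ M = 1 := by
      rw [hw, ← Complex.exp_nat_mul, Complex.exp_eq_one_iff]
      exact ⟨n, by field_simp⟩
    rw [geom_sum_eq h1, hwM, sub_self, zero_div]

/-- Orthogonality of the M-th roots of unity kills every exponent not divisible by M. -/
theorem HasQSeries.hasSum_average {f : ℍ → ℂ} {a : ℤ → ℂ} (hf : HasQSeries f a) (M : ℕ) [NeZero M]
    (τ : ℍ) : HasSum (fun n : ℤ => a (M * n) * nome τ ^ n)
      ((∑ j ∈ Finset.range M, f (transDiv M τ (j : ℤ))) / M) := by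
  have hM : (M : ℂ) ≠ 0 := by exact_mod_cast NeZero.ne M
  have h1 := (hasSum_sum fun (j : ℕ) (_ : j ∈ Finset.range M) => hf (transDiv M τ (j : ℤ))).div_const
    (M : ℂ)
  have h2 : ∀ n : ℤ, (∑ j ∈ Finset.range M, a n * nome (transDiv M τ (j : ℤ)) ^ n) / M
      = if (M : ℤ) ∣ n then a n * nome (transDiv M τ 0) ^ n else 0 := by
    intro n
    have : ∀ j : ℕ, a n * nome (transDiv M τ (j : ℤ)) ^ n = a n * nome (transDiv M τ 0) ^ n *
        Complex.exp (2 * Real.pi * Complex.I * ((j : ℤ) / M)) ^ n := by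
      intro j; rw [nome_transDiv, mul_zpow, ← mul_assoc]
    simp_rw [this]
    rw [← Finset.mul_sum, sum_exp_mul]
    split_ifs
    · field_simp
    · simp
  simp_rw [h2] at h1
  have hinj : Function.Injective fun n : ℤ => (M : ℤ) * n := fun m n h =>
    mul_left_cancel₀ (by exact_mod_cast NeZero.ne M) h
  rw [← hinj.hasSum_iff] at h1
  · refine h1.congr_fun fun n => ?_
    simp [nome_transDiv_zero_zpow]
  · intro n hn
    rw [if_neg]
    rintro ⟨k, rfl⟩
    exact hn ⟨k, rfl⟩

theorem HasQSeries.iterate_U_eq {f : ℍ → ℂ} {a : ℤ → ℂ} (hf : HasQSeries f a) {d : ℕ} (hd : 0 < d)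
    (k : ℕ) [NeZero (d ^ k)] (τ : ℍ) :
    (U d)^[k] f τ = (∑ j ∈ Finset.range (d ^ k), f (transDiv (d ^ k) τ (j : ℤ))) / (d ^ k : ℕ) := by
  have h1 := hf.iterate_U hd k τ
  have h2 := hf.hasSum_average (d ^ k) τ
  push_cast at h1 h2 ⊢
  exact h1.unique h2

/-- A series in q is 1-periodic, so the value at (τ+j)/M depends only on j mod M and representatives
may be chosen freely. -/
theorem HasQSeries.sum_reindex {f : ℍ → ℂ} {a : ℤ → ℂ} (hf : HasQSeries f a) (M : ℕ) [NeZero M]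
    (τ : ℍ) {r : ZMod M → ℤ} (hr : Function.Injective fun x => (r x : ZMod M)) :
    ∑ j ∈ Finset.range M, f (transDiv M τ (j : ℤ)) = ∑ x : ZMod M, f (transDiv M τ (r x)) := by
  have hb : Function.Bijective fun x => (r x : ZMod M) := Finite.injective_iff_bijective.1 hr
  have h1 : ∑ x : ZMod M, f (transDiv M τ (r x)) = ∑ x : ZMod M, f (transDiv M τ (x.val : ℤ)) := by
    refine Fintype.sum_bijective _ hb _ _ fun x => ?_
    exact hf.eq_of_nome_eq (nome_transDiv_congr M τ (by simp))
  rw [h1]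
  refine Finset.sum_bij' (fun j _ => (j : ZMod M)) (fun x _ => x.val) (by simp)
    (fun x _ => Finset.mem_range.2 (ZMod.val_lt x)) (fun j hj => ?_) (by simp) (fun j hj => ?_)
  · exact ZMod.val_natCast_of_lt (Finset.mem_range.1 hj)
  · rw [ZMod.val_natCast_of_lt (Finset.mem_range.1 hj)]

/-- Two functions which agree up to a constant on suitable systems of translates have iterates
of `U` which agree up to that constant. -/
theorem iterate_U_link {f g : ℍ → ℂ} {a b : ℤ → ℂ} (hf : HasQSeries f a) (hg : HasQSeries g b)
    {d : ℕ} (hd : 0 < d) (k : ℕ) [NeZero (d ^ k)] (κ : ℂ) (σ τ : ℍ) {r s : ZMod (d ^ k) → ℤ}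
    (hr : Function.Injective fun x => (r x : ZMod (d ^ k)))
    (hs : Function.Injective fun x => (s x : ZMod (d ^ k)))
    (h : ∀ x, f (transDiv (d ^ k) σ (r x)) = κ * g (transDiv (d ^ k) τ (s x))) :
    (U d)^[k] f σ = κ * (U d)^[k] g τ := by
  rw [hf.iterate_U_eq hd, hg.iterate_U_eq hd, hf.sum_reindex _ _ hr, hg.sum_reindex _ _ hs,
    Finset.sum_congr rfl fun x _ => h x, ← Finset.mul_sum, mul_div_assoc]

/-! ### The `q`-series of eta quotients -/

/-- `f` has the form `q^{r/24} R(q)`, where `R` is holomorphic without zeros in the unit disc. -/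
def IsEtaLike (r : ℤ) (f : ℍ → ℂ) : Prop :=
  ∃ R : ℂ → ℂ, DifferentiableOn ℂ R (Metric.ball 0 1) ∧ (∀ q ∈ Metric.ball (0 : ℂ) 1, R q ≠ 0) ∧
    ∀ τ : ℍ, f τ = Complex.exp (2 * Real.pi * Complex.I * (r * τ / 24)) * R (nome τ)

theorem nome_mem_ball (τ : ℍ) : nome τ ∈ Metric.ball (0 : ℂ) 1 := by
  rw [mem_ball_zero_iff]; exact UpperHalfPlane.norm_exp_two_pi_I_lt_one τ

theorem IsEtaLike.mul {r s : ℤ} {f g : ℍ → ℂ} (hf : IsEtaLike r f) (hg : IsEtaLike s g) :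
    IsEtaLike (r + s) fun τ => f τ * g τ := by
  obtain ⟨R, hR, hR0, h⟩ := hf
  obtain ⟨S, hS, hS0, h'⟩ := hg
  refine ⟨fun q => R q * S q, hR.mul hS, fun q hq => mul_ne_zero (hR0 q hq) (hS0 q hq), fun τ => ?_⟩
  simp only [h, h']
  rw [mul_mul_mul_comm, ← Complex.exp_add]
  congr 2; push_cast; ring

theorem IsEtaLike.div {r s : ℤ} {f g : ℍ → ℂ} (hf : IsEtaLike r f) (hg : IsEtaLike s g) :
    IsEtaLike (r - s) fun τ => f τ / g τ := by
  obtain ⟨R, hR, hR0, h⟩ := hf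
  obtain ⟨S, hS, hS0, h'⟩ := hg
  refine ⟨fun q => R q / S q, hR.div hS hS0, fun q hq => div_ne_zero (hR0 q hq) (hS0 q hq),
    fun τ => ?_⟩
  simp only [h, h']
  rw [mul_div_mul_comm, ← Complex.exp_sub]
  congr 2; push_cast; ring

theorem IsEtaLike.pow {r : ℤ} {f : ℍ → ℂ} (hf : IsEtaLike r f) (n : ℕ) :
    IsEtaLike (n * r) fun τ => f τ ^ n := by
  obtain ⟨R, hR, hR0, h⟩ := hf
  refine ⟨fun q => R q ^ n, hR.fun_pow n, fun q hq => pow_ne_zero n (hR0 q hq), fun τ => ?_⟩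
  simp only [h]
  rw [mul_pow, ← Complex.exp_nat_mul]
  congr 2; push_cast; ring

theorem isEtaLike_etaAt {δ : ℕ} (hδ : 0 < δ) : IsEtaLike δ (etaAt δ) := by
  have hmaps : ∀ q ∈ Metric.ball (0 : ℂ) 1, q ^ δ ∈ Metric.ball (0 : ℂ) 1 := by
    intro q hq
    rw [mem_ball_zero_iff] at hq ⊢
    rw [norm_pow]; exact pow_lt_one₀ (norm_nonneg _) hq hδ.ne'
  refine ⟨fun q => ∏' n : ℕ, (1 - (q ^ δ) ^ (n + 1)), ?_, ?_, ?_⟩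
  · exact differentiableOn_tprod_one_sub_pow.comp (by fun_prop) hmaps
  · intro q hq
    have h := hmaps q hq
    rw [mem_ball_zero_iff] at h
    simp_rw [sub_eq_add_neg]
    refine tprod_one_add_ne_zero_of_summable (fun n => ?_) ?_
    · rw [← sub_eq_add_neg, sub_ne_zero]
      intro h1
      have h2 : ‖(q ^ δ) ^ (n + 1)‖ < 1 := by
        rw [norm_pow]; exact pow_lt_one₀ (norm_nonneg _) h n.succ_ne_zero
      rw [← h1, norm_one] at h2
      exact lt_irrefl _ h2
    · simpa using (summable_nat_add_iff 1).mpr (summable_geometric_of_lt_one (norm_nonneg _) h)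
  · intro τ
    have h1 : Function.Periodic.qParam 1 (δ * τ) = nome τ ^ δ := by
      rw [Function.Periodic.qParam, nome, ← Complex.exp_nat_mul]
      congr 1; push_cast; ring
    have h2 : Function.Periodic.qParam 24 (δ * τ) =
        Complex.exp (2 * Real.pi * Complex.I * ((δ : ℤ) * τ / 24)) := by
      rw [Function.Periodic.qParam]; congr 1; push_cast; ring
    simp only [etaAt, eta, eta_q, h1, h2]

/-- When 24 divides r the prefactor is an integral power of q, and the Taylor series of R on the
unit disc is shifted by it. -/
theorem IsEtaLike.hasQSeries {r : ℤ} {f : ℍ → ℂ} (hf : IsEtaLike r f) (hr : 24 ∣ r) :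
    ∃ a, HasQSeries f a := by
  obtain ⟨R, hR, -, h⟩ := hf
  obtain ⟨m, rfl⟩ := hr
  let c : ℕ → ℂ := fun n => (n.factorial : ℂ)⁻¹ * iteratedDeriv n R 0
  have hc : ∀ q ∈ Metric.ball (0 : ℂ) 1, HasSum (fun n : ℕ => c n * q ^ n) (R q) := by
    intro q hq
    have := Complex.hasSum_taylorSeries_on_ball (f := R) (c := 0) (r := 1) (by simpa using hR)
      (by simpa using hq)
    refine this.congr_fun fun n => ?_
    simp only [c, sub_zero, smul_eq_mul]; ring
  have hinj : Function.Injective fun n : ℕ => (n : ℤ) + m := fun i j hij => by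
    simpa using hij
  refine ⟨fun n => if m ≤ n then c (n - m).toNat else 0, fun τ => ?_⟩
  rw [← hinj.hasSum_iff]
  · have h1 := (hc _ (nome_mem_ball τ)).mul_left (nome τ ^ m)
    have h2 : f τ = nome τ ^ m * R (nome τ) := by
      rw [h, nome, ← Complex.exp_int_mul]; congr 2; push_cast; ring
    rw [h2]
    refine h1.congr_fun fun n => ?_
    simp only [Function.comp]
    rw [if_pos (by omega), add_sub_cancel_right, Int.toNat_natCast, zpow_add₀ (nome_ne_zero τ),
      zpow_natCast]
    ring
  · intro n hn
    have : ¬ m ≤ n := fun hmn => hn ⟨(n - m).toNat, by simp [hmn]⟩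
    simp [this]

/-! ### The four eta quotients under integral matrices of level `6M²` -/

theorem zmod_cast_eq {n : ℕ} {x y : ℤ} (h : (n : ℤ) ∣ x - y) : (x : ZMod n) = y :=
  ((ZMod.intCast_eq_intCast_iff_dvd_sub y x n).2 h).symm

/-- A matrix with rows `(a, b)`, `(6M², d)` in the residue classes relevant for the link. -/
structure LinkMatrix (M k a b d : ℤ) : Prop where
  hM : M = 27 + 216 * k
  ha : 48 ∣ a - (83 + 648 * k)
  hd : 48 ∣ d - (41 + 324 * k)
  det : a * d - b * (6 * M ^ 2) = 1
  pos : 0 < d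

namespace LinkMatrix

variable {M k a b d : ℤ}

theorem b_mod (h : LinkMatrix M k a b d) : 8 ∣ b - (7 + 6 * k) := by
  obtain ⟨rfl, ⟨x, hx⟩, ⟨y, hy⟩, det, -⟩ := h
  have hx' : a = 83 + 648 * k + 48 * x := by linarith
  have hy' : d = 41 + 324 * k + 48 * y := by linarith
  subst hx' hy'
  -- M is odd, so 6M² ≡ 6 mod 48 and the determinant fixes 6b mod 48. The witness is the expanded
  -- quotient.
  have : 48 ∣ 6 * (b - (7 + 6 * k)) := by
    refine ⟨70 + k * 1113 + 83 * y + 41 * x + 4374 * k ^ 2 + 648 * k * y + 324 * k * x + 48 * x * y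
      - b * (91 + 1458 * k + 5832 * k ^ 2), ?_⟩
    linear_combination -det
  omega

theorem det_mul (h : LinkMatrix M k a b d) (m c : ℤ) (hmc : m * c = 6 * M ^ 2) :
    a * d - m * b * c = 1 := by
  linear_combination h.det - b * hmc

/-- The exponent of a product of squares of eta functions, determined modulo `12`. -/
theorem etaSqExp_mod (h : LinkMatrix M k a b d) (m₁ m₂ m₃ m₄ r : ℤ)
    (hr : ∀ κ : ZMod 4, m₁ * etaSqExp 3 (3 * (3 + 2 * κ)) 2 1
      + m₂ * etaSqExp 3 (2 * (3 + 2 * κ)) 1 1 + m₃ * etaSqExp 3 (3 + 2 * κ) 2 1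
      + m₄ * etaSqExp 3 (2 * (3 + 2 * κ)) 3 1 = r) (hr3 : (3 : ℤ) ∣ r) :
    12 ∣ m₁ * etaSqExp a (M * b) (6 * M) d + m₂ * etaSqExp a (2 * M * b) (3 * M) d
      + m₃ * etaSqExp a (3 * M * b) (2 * M) d + m₄ * etaSqExp a (6 * M * b) M d - r := by
  have hb := h.b_mod
  obtain ⟨rfl, ha, hd, -, -⟩ := h
  apply dvd_twelve_of_cast
  · have e1 : ((27 + 216 * k : ℤ) : ZMod 3) = ((0 : ℤ) : ZMod 3) := zmod_cast_eq (by push_cast; omega)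
    have e2 : (r : ZMod 3) = ((0 : ℤ) : ZMod 3) := zmod_cast_eq (by push_cast; omega)
    have e3 : (a : ZMod 3) = ((2 : ℤ) : ZMod 3) := zmod_cast_eq (by push_cast; omega)
    have e4 : (d : ZMod 3) = ((2 : ℤ) : ZMod 3) := zmod_cast_eq (by push_cast; omega)
    have z3 : (3 : ZMod 3) = 0 := rfl
    rw [Int.cast_sub, e2]
    simp only [Int.cast_add, Int.cast_mul, etaSqExp_cast] at e1 ⊢
    simp only [e1, e3, e4, etaSqExp]
    simp [z3]
  · have e1 : ((27 + 216 * k : ℤ) : ZMod 4) = ((3 : ℤ) : ZMod 4) := zmod_cast_eq (by push_cast; omega)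
    have e2 : (b : ZMod 4) = ((3 + 2 * k : ℤ) : ZMod 4) := zmod_cast_eq (by push_cast; omega)
    have e3 : (a : ZMod 4) = ((3 : ℤ) : ZMod 4) := zmod_cast_eq (by push_cast; omega)
    have e4 : (d : ZMod 4) = ((1 : ℤ) : ZMod 4) := zmod_cast_eq (by push_cast; omega)
    rw [Int.cast_sub, ← hr k, sub_eq_zero]
    simp only [Int.cast_add, Int.cast_mul, etaSqExp_cast] at e1 e2 ⊢
    simp only [e1, e2, e3, e4]
    have n1 : ((6 : ℤ) : ZMod 4) * ((3 : ℤ) : ZMod 4) = 2 := by decide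
    have n2 : ((3 : ℤ) : ZMod 4) * ((3 : ℤ) : ZMod 4) = 1 := by decide
    have n3 : ((2 : ℤ) : ZMod 4) * ((3 : ℤ) : ZMod 4) = 2 := by decide
    have n4 : ((1 : ℤ) : ZMod 4) = 1 := by decide
    have n5 : ((3 : ℤ) : ZMod 4) = 3 := by decide
    have n6 : ((2 : ℤ) : ZMod 4) = 2 := by decide
    simp only [n1, n2, n3]
    simp only [n4, n5, n6, one_mul]

/-- With c = 6M²/m, e = (c - 2d)/4 is the coset parameter for η-quotients in mz: m = 1 here, m = 3M
and m = M in the next two lemmas. The roots of unity see e only modulo 8. -/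
theorem exists_cusp_one (h : LinkMatrix M k a b d) :
    ∃ e : ℤ, 6 * M ^ 2 = 4 * e + 2 * d ∧ 8 ∣ e - (1 + 6 * k) := by
  obtain ⟨rfl, -, ⟨y, hy⟩, -, -⟩ := h
  exact ⟨1073 + 17334 * k + 69984 * k ^ 2 - 24 * y, by linear_combination -2 * hy,
    ⟨134 + 2166 * k + 8748 * k ^ 2 - 3 * y, by ring⟩⟩

theorem exists_cusp_three (h : LinkMatrix M k a b d) :
    ∃ e : ℤ, 2 * M = 4 * e + 2 * d ∧ 8 ∣ e - (1 + 2 * k) := by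
  obtain ⟨rfl, -, ⟨y, hy⟩, -, -⟩ := h
  exact ⟨-7 - 54 * k - 24 * y, by linear_combination -2 * hy,
    ⟨-1 - 7 * k - 3 * y, by ring⟩⟩

theorem exists_cusp_level (h : LinkMatrix M k a b d) :
    ∃ e : ℤ, 6 * M = 4 * e + 2 * d ∧ 8 ∣ e - (4 + 2 * k) := by
  obtain ⟨rfl, -, ⟨y, hy⟩, -, -⟩ := h
  exact ⟨20 + 162 * k - 24 * y, by linear_combination -2 * hy,
    ⟨2 + 20 * k - 3 * y, by ring⟩⟩

/-- Modulo 48 the squares contribute 4 times a class mod 12 and the level 4 quotients 6 times a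
class mod 8. Both classes are determined by k; they give 4·6 and 6·4k, together 24(k+1). -/
theorem ped_exponent (h : LinkMatrix M k a b d) {e₁ e₃ : ℤ} (h₁ : 8 ∣ e₁ - (1 + 6 * k))
    (h₃ : 8 ∣ e₃ - (1 + 2 * k)) :
    rou (4 * etaSqExp a (6 * M * b) M d) ^ 2 * rou (6 * ((b + e₁) * d) + 3) =
      rou (24 * (k + 1)) * (rou (4 * etaSqExp a (M * b) (6 * M) d) *
        rou (4 * etaSqExp a (3 * M * b) (2 * M) d) * rou (6 * ((3 * M * b + e₃) * d) + 3)) := by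
  have hx := h.etaSqExp_mod (-1) 0 (-1) 2 6 (by unfold etaSqExp; decide) (by norm_num)
  have hy : 8 ∣ (b + e₁) * d - (3 * M * b + e₃) * d - 4 * k := by
    have hb := h.b_mod
    obtain ⟨hM, -, hd, -, -⟩ := h
    have c1 : (M : ZMod 8) = ((3 : ℤ) : ZMod 8) := zmod_cast_eq (by push_cast; omega)
    have c2 : (b : ZMod 8) = ((7 + 6 * k : ℤ) : ZMod 8) := zmod_cast_eq (by exact_mod_cast hb)
    have c3 : (d : ZMod 8) = ((1 + 4 * k : ℤ) : ZMod 8) := zmod_cast_eq (by push_cast; omega)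
    have c4 : (e₁ : ZMod 8) = ((1 + 6 * k : ℤ) : ZMod 8) := zmod_cast_eq (by exact_mod_cast h₁)
    have c5 : (e₃ : ZMod 8) = ((1 + 2 * k : ℤ) : ZMod 8) := zmod_cast_eq (by exact_mod_cast h₃)
    refine (ZMod.intCast_zmod_eq_zero_iff_dvd _ 8).1 ?_
    push_cast at c1 c2 c3 c4 c5 ⊢
    rw [c1, c2, c3, c4, c5]
    generalize (k : ZMod 8) = κ
    revert κ; decide
  rw [← rou_mul_nat, ← rou_add, ← rou_add, ← rou_add, ← rou_add]
  apply rou_congr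
  push_cast
  generalize (b + e₁) * d = u at *
  generalize (3 * M * b + e₃) * d = v at *
  omega

theorem pod_exponent (h : LinkMatrix M k a b d) {e₁ e₃ e : ℤ} (h₁ : 8 ∣ e₁ - (1 + 6 * k))
    (h₃ : 8 ∣ e₃ - (1 + 2 * k)) (he : 8 ∣ e - (4 + 2 * k)) :
    rou (4 * etaSqExp a (2 * M * b) (3 * M) d) ^ 2 * rou (4 * etaSqExp a (M * b) (6 * M) d) *
        rou (6 * ((M * b + e) * d) + 3) ^ 6 =
      rou (24 * (k + 1)) * (rou (4 * etaSqExp a (3 * M * b) (2 * M) d) *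
        rou (4 * etaSqExp a (6 * M * b) M d) * rou (6 * ((3 * M * b - e₃) * d) - 3) *
        rou (6 * ((b - e₁) * d) - 3)) := by
  have hx := h.etaSqExp_mod 1 2 (-1) (-1) 9 (by unfold etaSqExp; decide) (by norm_num)
  have hy : 8 ∣ 6 * ((M * b + e) * d) - (3 * M * b - e₃) * d - (b - e₁) * d - (2 + 4 * k) := by
    have hb := h.b_mod
    obtain ⟨hM, -, hd, -, -⟩ := h
    have c1 : (M : ZMod 8) = ((3 : ℤ) : ZMod 8) := zmod_cast_eq (by push_cast; omega)
    have c2 : (b : ZMod 8) = ((7 + 6 * k : ℤ) : ZMod 8) := zmod_cast_eq (by exact_mod_cast hb)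
    have c3 : (d : ZMod 8) = ((1 + 4 * k : ℤ) : ZMod 8) := zmod_cast_eq (by push_cast; omega)
    have c4 : (e₁ : ZMod 8) = ((1 + 6 * k : ℤ) : ZMod 8) := zmod_cast_eq (by exact_mod_cast h₁)
    have c5 : (e₃ : ZMod 8) = ((1 + 2 * k : ℤ) : ZMod 8) := zmod_cast_eq (by exact_mod_cast h₃)
    have c6 : (e : ZMod 8) = ((4 + 2 * k : ℤ) : ZMod 8) := zmod_cast_eq (by exact_mod_cast he)
    refine (ZMod.intCast_zmod_eq_zero_iff_dvd _ 8).1 ?_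
    push_cast at c1 c2 c3 c4 c5 c6 ⊢
    rw [c1, c2, c3, c4, c5, c6]
    generalize (k : ZMod 8) = κ
    revert κ; decide
  rw [← rou_mul_nat, ← rou_mul_nat, ← rou_add, ← rou_add, ← rou_add, ← rou_add, ← rou_add,
    ← rou_add]
  apply rou_congr
  push_cast
  generalize (b - e₁) * d = u at *
  generalize (3 * M * b - e₃) * d = v at *
  generalize (M * b + e) * d = w at *
  omega

/-- Since 4e ≡ c mod d, the symbols are those of 2M and 6M², and 2M·6M² = (2MN)². -/
theorem jac_mul_jac (h : LinkMatrix M k a b d) {e₁ e₃ N : ℤ} (h₁ : 6 * M ^ 2 = 4 * e₁ + 2 * d)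
    (h₃ : 2 * M = 4 * e₃ + 2 * d) (hN : 3 * M = N * N) : jac e₃ d * jac e₁ d = 1 := by
  have hcop : IsCoprime (6 * M ^ 2) d := ⟨-b, a, by linear_combination h.det⟩
  have c2 : IsCoprime 2 d := hcop.of_isCoprime_of_dvd_left ⟨3 * M ^ 2, by ring⟩
  have cM : IsCoprime M d := hcop.of_isCoprime_of_dvd_left ⟨6 * M, by ring⟩
  have cN : IsCoprime N d := hcop.of_isCoprime_of_dvd_left ⟨N * (2 * M), by
    linear_combination (2 * M) * hN⟩
  have k1 : jac (2 * 2) d = 1 := by rw [jac_mul_left, jac_mul_self c2 h.pos]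
  have s1 : jac e₁ d = jac (6 * M ^ 2) d := by
    rw [h₁, jac_add_right _ h.pos, show (4 : ℤ) * e₁ = 2 * 2 * e₁ by ring, jac_mul_left, k1,
      one_mul]
  have s3 : jac e₃ d = jac (2 * M) d := by
    rw [h₃, jac_add_right _ h.pos, show (4 : ℤ) * e₃ = 2 * 2 * e₃ by ring, jac_mul_left, k1,
      one_mul]
  rw [s1, s3, ← jac_mul_left, show 2 * M * (6 * M ^ 2) = (2 * M * N) * (2 * M * N) by
    linear_combination (4 * M ^ 2) * hN, jac_mul_left]
  exact jac_mul_self ((c2.mul_left cM).mul_left cN) h.pos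

end LinkMatrix

/-! ### Algebra assembling the quotients from the laws of their factors -/

theorem ped_algebra {q₁ q₃ q₆ q₁₂ x₁ x₄ p₁ p₃ p₆ p₁₂ y₁ y₂ y₄ D v r₁ r₃ r₆ rF rG s : ℂ}
    (hq₁ : q₁ ≠ 0) (hq₃ : q₃ ≠ 0) (hq₁₂ : q₁₂ ≠ 0) (hp₁ : p₁ ≠ 0) (hp₃ : p₃ ≠ 0)
    (hp₆ : p₆ ≠ 0) (hp₁₂ : p₁₂ ≠ 0) (hy₁ : y₁ ≠ 0) (hy₄ : y₄ ≠ 0) (hD : D ≠ 0) (hv : v ≠ 0)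
    (hr₁ : r₁ ≠ 0) (hr₃ : r₃ ≠ 0) (hrG : rG ≠ 0)
    (h₁ : q₁ ^ 2 = r₁ * D * p₁ ^ 2) (h₃ : q₃ ^ 2 = r₃ * D * p₃ ^ 2) (h₆ : q₆ ^ 2 = r₆ * D * p₆ ^ 2)
    (hF : x₄ / x₁ = rF / v * (y₂ ^ 3 / (y₁ ^ 2 * y₄)))
    (hG : q₁₂ / q₃ = rG / v * (p₆ ^ 3 / (p₃ ^ 2 * p₁₂)))
    (hr : r₆ ^ 2 * rF = s * (r₁ * r₃ * rG)) :
    q₆ ^ 4 / (q₁ ^ 2 * q₃ * q₁₂) * (x₄ / x₁) =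
      s * (p₆ * p₁₂ / p₁ ^ 2 * (y₂ ^ 3 / (y₁ ^ 2 * y₄))) := by
  -- 12M does not divide 6M², so η(12Mz) is only available through η(12Mz)/η(3Mz). Afterwards D and
  -- v cancel.
  have e : q₆ ^ 4 / (q₁ ^ 2 * q₃ * q₁₂) = (q₆ ^ 2) ^ 2 / (q₁ ^ 2 * q₃ ^ 2 * (q₁₂ / q₃)) := by
    field_simp
  rw [e, hF, hG, h₁, h₃, h₆]
  field_simp
  linear_combination y₂ ^ 3 * hr

theorem pod_algebra {q₁ q₂ q₃ q₄ q₆ q₁₂ x₁ x₂ x₄ p₁ p₂ p₃ p₄ p₆ p₁₂ y₂ y₄ D S v r₁ r₂ r₃ r₆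
    rF rA rB jA jB s : ℂ}
    (hq₁ : q₁ ≠ 0) (hq₃ : q₃ ≠ 0) (hq₆ : q₆ ≠ 0) (hq₁₂ : q₁₂ ≠ 0) (hx₁ : x₁ ≠ 0) (hx₂ : x₂ ≠ 0)
    (hx₄ : x₄ ≠ 0) (hp₁ : p₁ ≠ 0) (hp₃ : p₃ ≠ 0) (hp₄ : p₄ ≠ 0) (hp₆ : p₆ ≠ 0) (hp₁₂ : p₁₂ ≠ 0)
    (hy₂ : y₂ ≠ 0) (hy₄ : y₄ ≠ 0) (hS : S ≠ 0) (hv : v ≠ 0) (hr₃ : r₃ ≠ 0) (hr₆ : r₆ ≠ 0)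
    (hrA : rA ≠ 0) (hrB : rB ≠ 0) (hSD : S * S = D) (hv2 : v * v = 2) (hj : jA * jB = 1)
    (h₁ : q₁ ^ 2 = r₁ * D * p₁ ^ 2) (h₂ : q₂ ^ 2 = r₂ * D * p₂ ^ 2)
    (h₃ : q₃ ^ 2 = r₃ * D * p₃ ^ 2) (h₆ : q₆ ^ 2 = r₆ * D * p₆ ^ 2)
    (hF : q₄ / q₁ = rF / v * (p₂ ^ 3 / (p₁ ^ 2 * p₄)))
    (hA : q₃ * q₁₂ / q₆ = jA * rA / v * S * (p₆ ^ 2 / p₁₂))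
    (hB : x₁ * x₄ / x₂ = jB * rB / v * S * (y₂ ^ 2 / y₄))
    (hr : r₂ ^ 2 * r₁ * rF ^ 6 = s * (r₃ * r₆ * rA * rB)) :
    q₂ ^ 4 * q₄ ^ 6 / (q₁ ^ 4 * q₃ ^ 3 * q₆ * q₁₂) * (x₂ / (x₁ * x₄)) =
      s * (1 / 4) * (p₂ ^ 22 * p₁₂ / (p₁ ^ 10 * p₃ ^ 2 * p₄ ^ 6 * p₆ ^ 4) * (y₄ / y₂ ^ 2)) := by
  have e : q₂ ^ 4 * q₄ ^ 6 / (q₁ ^ 4 * q₃ ^ 3 * q₆ * q₁₂) * (x₂ / (x₁ * x₄)) =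
      (q₂ ^ 2) ^ 2 * q₁ ^ 2 * (q₄ / q₁) ^ 6 /
        (q₃ ^ 2 * q₆ ^ 2 * ((q₃ * q₁₂ / q₆) * (x₁ * x₄ / x₂))) := by
    field_simp
  -- The two factors of weight 1/2 give D/2, and the sixth power in `e3` gives 1/8; their quotient
  -- is the source of 1/4.
  have e2 : (jA * rA / v * S * (p₆ ^ 2 / p₁₂)) * (jB * rB / v * S * (y₂ ^ 2 / y₄)) =
      D / 2 * (rA * rB * (p₆ ^ 2 / p₁₂) * (y₂ ^ 2 / y₄)) := by
    rw [← hSD, ← hv2]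
    field_simp
    linear_combination hj
  have e3 : (rF / v * (p₂ ^ 3 / (p₁ ^ 2 * p₄))) ^ 6 = rF ^ 6 / 8 * (p₂ ^ 3 / (p₁ ^ 2 * p₄)) ^ 6 := by
    rw [show (8 : ℂ) = (v * v) ^ 3 by rw [hv2]; norm_num]
    field_simp
  have hD : D ≠ 0 := hSD ▸ mul_ne_zero hS hS
  rw [e, hF, hA, hB, e2, e3, h₁, h₂, h₃, h₆]
  field_simp
  linear_combination 8 * p₂ ^ 22 * hr

theorem nat_mul_mob (m : ℕ) (a b c d : ℤ) (z : ℂ) {c' : ℤ} (hc : m * c = c') :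
    (m : ℂ) * mob a b c' d z = mob a (m * b) c d (m * z) := by
  rw [← hc]
  exact_mod_cast mul_mob m a b c d z

/-! ### Transformation of the full eta quotients -/

namespace LinkMatrix

variable {M : ℕ} {k a b d : ℤ}

/-- The transformation law of `η(mz)²` for `m ∣ 6M²`. -/
theorem eta_mul_sq (h : LinkMatrix M k a b d) {m : ℕ} {c : ℤ} (hm : 0 < m)
    (hmc : m * c = 6 * (M : ℤ) ^ 2) {w : ℂ} (hw : 0 < w.im) :
    eta (m * mob a b (6 * (M : ℤ) ^ 2) d w) ^ 2 =
      rou (4 * etaSqExp a (m * b) c d) * (6 * M ^ 2 * w + d) * eta (m * w) ^ 2 := by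
  rw [nat_mul_mob m a b c d w hmc, eta_sq_mob (h.det_mul m c hmc) (im_natCast_mul_pos hw hm)]
  have : (c : ℂ) * (m * w) = 6 * M ^ 2 * w := by
    have := congrArg (Int.cast (R := ℂ)) hmc
    push_cast at this
    rw [← this]; ring
  rw [this]

theorem fourQuot_mul (h : LinkMatrix M k a b d) {m : ℕ} {c e : ℤ} (hm : 0 < m)
    (hmc : m * c = 6 * (M : ℤ) ^ 2) (he : c = 4 * e + 2 * d) {w : ℂ} (hw : 0 < w.im) :
    fourQuot (m * mob a b (6 * (M : ℤ) ^ 2) d w) =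
      rou (6 * ((m * b + e) * d) + 3) / Complex.sqrt (2 : ℝ) * fourQuotHalf (m * w) := by
  rw [nat_mul_mob m a b c d w hmc,
    fourQuot_mob (h.det_mul m c hmc) he (im_natCast_mul_pos hw hm)]

theorem psiQuot_mul (h : LinkMatrix M k a b d) {m : ℕ} {c e : ℤ} (hm : 0 < m)
    (hmc : m * c = 6 * (M : ℤ) ^ 2) (he : c = 4 * e + 2 * d) {w : ℂ} (hw : 0 < w.im) :
    psiQuot (m * mob a b (6 * (M : ℤ) ^ 2) d w) =
      jac e d * rou (6 * ((m * b - e) * d) - 3) / Complex.sqrt (2 : ℝ) *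
        Complex.sqrt (6 * M ^ 2 * w + d) * psiQuotHalf (m * w) := by
  have hd4 : d % 4 = 1 := by have := h.hd; omega
  rw [nat_mul_mob m a b c d w hmc,
    psiQuot_mob (h.det_mul m c hmc) he h.pos hd4 (im_natCast_mul_pos hw hm)]
  have : (c : ℂ) * (m * w) = 6 * M ^ 2 * w := by
    have := congrArg (Int.cast (R := ℂ)) hmc
    push_cast at this
    rw [← this]; ring
  rw [this]

theorem denom_ne_zero (h : LinkMatrix M k a b d) {w : ℂ} (hw : 0 < w.im) :
    (6 * M ^ 2 * w + d : ℂ) ≠ 0 := by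
  have := mob_denom_ne_zero h.det hw
  push_cast at this
  exact this

theorem ped_transform (h : LinkMatrix M k a b d) {w : ℂ} (hw : 0 < w.im) {z : ℂ}
    (hz : z = mob a b (6 * (M : ℤ) ^ 2) d w) :
    eta ((6 * M : ℕ) * z) ^ 4
      / (eta (M * z) ^ 2 * eta ((3 * M : ℕ) * z) * eta ((12 * M : ℕ) * z))
      * (eta ((4 : ℕ) * z) / eta ((1 : ℕ) * z))
    = rou (24 * (k + 1)) * (eta ((6 * M : ℕ) * w) * eta ((12 * M : ℕ) * w) / eta (M * w) ^ 2
      * (eta ((2 : ℕ) * w) ^ 3 / (eta ((1 : ℕ) * w) ^ 2 * eta ((4 : ℕ) * w)))) := by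
  have hM0 : 0 < M := by
    have := h.hM
    omega
  have hz0 : 0 < z.im := hz ▸ im_mob_pos h.det hw
  obtain ⟨e₁, he₁, m₁⟩ := h.exists_cusp_one
  obtain ⟨e₃, he₃, m₃⟩ := h.exists_cusp_three
  have h1 := h.eta_mul_sq (m := M) (c := 6 * M) hM0 (by ring) hw
  have h3 := h.eta_mul_sq (m := 3 * M) (c := 2 * M) (by omega) (by push_cast; ring) hw
  have h6 := h.eta_mul_sq (m := 6 * M) (c := M) (by omega) (by push_cast; ring) hw
  have hF := h.fourQuot_mul (m := 1) (c := 6 * M ^ 2) one_pos (by push_cast; ring) he₁ hw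
  have hG := h.fourQuot_mul (m := 3 * M) (c := 2 * M) (by omega) (by push_cast; ring) he₃ hw
  have hr := h.ped_exponent m₁ m₃
  rw [← hz] at h1 h3 h6 hF hG
  have hF4 : 4 * (((1 : ℕ) : ℂ) * z) = (4 : ℕ) * z := by push_cast; ring
  have hG4 : 4 * (((3 * M : ℕ) : ℂ) * z) = (12 * M : ℕ) * z := by push_cast; ring
  have wF2 : 2 * (((1 : ℕ) : ℂ) * w) = (2 : ℕ) * w := by push_cast; ring
  have wF4 : 4 * (((1 : ℕ) : ℂ) * w) = (4 : ℕ) * w := by push_cast; ring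
  have wG2 : 2 * (((3 * M : ℕ) : ℂ) * w) = (6 * M : ℕ) * w := by push_cast; ring
  have wG4 : 4 * (((3 * M : ℕ) : ℂ) * w) = (12 * M : ℕ) * w := by push_cast; ring
  rw [fourQuot, fourQuotHalf, hF4, wF2, wF4] at hF
  rw [fourQuot, fourQuotHalf, hG4, wG2, wG4] at hG
  have nz : ∀ {m : ℕ}, 0 < m → eta (m * z) ≠ 0 := fun hm => eta_natCast_mul_ne_zero hz0 hm
  have nw : ∀ {m : ℕ}, 0 < m → eta (m * w) ≠ 0 := fun hm => eta_natCast_mul_ne_zero hw hm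
  refine ped_algebra (nz hM0) (nz (by omega)) (nz (by omega)) (nw hM0) (nw (m := 3 * M) (by omega))
    (nw (by omega)) (nw (by omega)) (nw one_pos) (nw four_pos) (h.denom_ne_zero hw)
    sqrt_two_ne_zero (rou_ne_zero _) (rou_ne_zero _) (rou_ne_zero _) h1 h3 h6 hF hG ?_
  push_cast at hr ⊢
  rw [one_mul]
  exact hr

theorem pod_transform (h : LinkMatrix M k a b d) {N : ℤ} (hN : 3 * (M : ℤ) = N * N) {w : ℂ}
    (hw : 0 < w.im) {z : ℂ} (hz : z = mob a b (6 * (M : ℤ) ^ 2) d w) :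
    eta ((2 * M : ℕ) * z) ^ 4 * eta ((4 * M : ℕ) * z) ^ 6
      / (eta (M * z) ^ 4 * eta ((3 * M : ℕ) * z) ^ 3 * eta ((6 * M : ℕ) * z)
        * eta ((12 * M : ℕ) * z))
      * (eta ((2 : ℕ) * z) / (eta ((1 : ℕ) * z) * eta ((4 : ℕ) * z)))
    = rou (24 * (k + 1)) * (1 / 4) * (eta ((2 * M : ℕ) * w) ^ 22 * eta ((12 * M : ℕ) * w)
      / (eta (M * w) ^ 10 * eta ((3 * M : ℕ) * w) ^ 2 * eta ((4 * M : ℕ) * w) ^ 6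
        * eta ((6 * M : ℕ) * w) ^ 4) * (eta ((4 : ℕ) * w) / eta ((2 : ℕ) * w) ^ 2)) := by
  have hM0 : 0 < M := by
    have := h.hM
    omega
  have hz0 : 0 < z.im := hz ▸ im_mob_pos h.det hw
  obtain ⟨e₁, he₁, m₁⟩ := h.exists_cusp_one
  obtain ⟨e₃, he₃, m₃⟩ := h.exists_cusp_three
  obtain ⟨e, he, m⟩ := h.exists_cusp_level
  have h1 := h.eta_mul_sq (m := M) (c := 6 * M) hM0 (by ring) hw
  have h2 := h.eta_mul_sq (m := 2 * M) (c := 3 * M) (by omega) (by push_cast; ring) hw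
  have h3 := h.eta_mul_sq (m := 3 * M) (c := 2 * M) (by omega) (by push_cast; ring) hw
  have h6 := h.eta_mul_sq (m := 6 * M) (c := M) (by omega) (by push_cast; ring) hw
  have hF := h.fourQuot_mul (m := M) (c := 6 * M) hM0 (by ring) he hw
  have hA := h.psiQuot_mul (m := 3 * M) (c := 2 * M) (by omega) (by push_cast; ring) he₃ hw
  have hB := h.psiQuot_mul (m := 1) (c := 6 * M ^ 2) one_pos (by push_cast; ring) he₁ hw
  have hr := h.pod_exponent m₁ m₃ m
  rw [← hz] at h1 h2 h3 h6 hF hA hB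
  have zF4 : 4 * ((M : ℂ) * z) = (4 * M : ℕ) * z := by push_cast; ring
  have zA2 : 2 * (((3 * M : ℕ) : ℂ) * z) = (6 * M : ℕ) * z := by push_cast; ring
  have zA4 : 4 * (((3 * M : ℕ) : ℂ) * z) = (12 * M : ℕ) * z := by push_cast; ring
  have zB2 : 2 * (((1 : ℕ) : ℂ) * z) = (2 : ℕ) * z := by push_cast; ring
  have zB4 : 4 * (((1 : ℕ) : ℂ) * z) = (4 : ℕ) * z := by push_cast; ring
  have wF2 : 2 * ((M : ℂ) * w) = (2 * M : ℕ) * w := by push_cast; ring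
  have wF4 : 4 * ((M : ℂ) * w) = (4 * M : ℕ) * w := by push_cast; ring
  have wA2 : 2 * (((3 * M : ℕ) : ℂ) * w) = (6 * M : ℕ) * w := by push_cast; ring
  have wA4 : 4 * (((3 * M : ℕ) : ℂ) * w) = (12 * M : ℕ) * w := by push_cast; ring
  have wB2 : 2 * (((1 : ℕ) : ℂ) * w) = (2 : ℕ) * w := by push_cast; ring
  have wB4 : 4 * (((1 : ℕ) : ℂ) * w) = (4 : ℕ) * w := by push_cast; ring
  rw [fourQuot, fourQuotHalf, zF4, wF2, wF4] at hF
  rw [psiQuot, psiQuotHalf, zA2, zA4, wA2, wA4] at hA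
  rw [psiQuot, psiQuotHalf, zB2, zB4, wB2, wB4] at hB
  have nz : ∀ {m : ℕ}, 0 < m → eta (m * z) ≠ 0 := fun hm => eta_natCast_mul_ne_zero hz0 hm
  have nw : ∀ {m : ℕ}, 0 < m → eta (m * w) ≠ 0 := fun hm => eta_natCast_mul_ne_zero hw hm
  refine pod_algebra (nz hM0) (nz (by omega)) (nz (by omega)) (nz (by omega)) (nz one_pos)
    (nz two_pos) (nz four_pos) (nw hM0) (nw (by omega)) (nw (by omega)) (nw (by omega))
    (nw (by omega)) (nw two_pos) (nw four_pos) (sqrt_ne_zero (h.denom_ne_zero hw))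
    sqrt_two_ne_zero (rou_ne_zero _) (rou_ne_zero _) (rou_ne_zero _) (rou_ne_zero _)
    (sqrt_mul_self _) sqrt_two_mul_self (h.jac_mul_jac he₁ he₃ hN) h1 h2 h3 h6 hF hA hB ?_
  push_cast at hr ⊢
  rw [one_mul]
  exact hr

end LinkMatrix

/-! ### The `q`-series of the four modular functions -/

theorem three_pow_odd (α : ℕ) : ∃ m : ℕ, 3 ^ (2 * α + 1) = 24 * m + 3 := by
  induction α with
  | zero => exact ⟨0, by norm_num⟩
  | succ α ih =>
    obtain ⟨m, hm⟩ := ih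
    refine ⟨9 * m + 1, ?_⟩
    rw [show 2 * (α + 1) + 1 = 2 * α + 1 + 2 by ring, pow_add, hm]; ring

theorem hasQSeries_Pped (α : ℕ) : ∃ a, HasQSeries (Pped α) a := by
  have hpos : 0 < 3 ^ (2 * α + 1) := by positivity
  obtain ⟨m, hm⟩ := three_pow_odd α
  have e : ∀ c : ℕ, 0 < c → IsEtaLike ((c * 3 ^ (2 * α + 1) : ℕ) : ℤ) (etaAt (c * 3 ^ (2 * α + 1))) :=
    fun c hc => isEtaLike_etaAt (Nat.mul_pos hc hpos)
  have e1 := isEtaLike_etaAt hpos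
  have key := (((e 6 (by norm_num)).pow 4).div (((e1.pow 2).mul (e 3 (by norm_num))).mul
    (e 12 (by norm_num)))).mul ((isEtaLike_etaAt four_pos).div (isEtaLike_etaAt one_pos))
  refine IsEtaLike.hasQSeries (f := Pped α) key ?_
  rw [hm]; push_cast; omega

theorem hasQSeries_Ppod (α : ℕ) : ∃ a, HasQSeries (Ppod α) a := by
  have hpos : 0 < 3 ^ (2 * α + 1) := by positivity
  obtain ⟨m, hm⟩ := three_pow_odd α
  have e : ∀ c : ℕ, 0 < c → IsEtaLike ((c * 3 ^ (2 * α + 1) : ℕ) : ℤ) (etaAt (c * 3 ^ (2 * α + 1))) :=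
    fun c hc => isEtaLike_etaAt (Nat.mul_pos hc hpos)
  have e1 := isEtaLike_etaAt hpos
  have key := ((((e 2 (by norm_num)).pow 4).mul ((e 4 (by norm_num)).pow 6)).div
    ((((e1.pow 4).mul ((e 3 (by norm_num)).pow 3)).mul (e 6 (by norm_num))).mul
    (e 12 (by norm_num)))).mul ((isEtaLike_etaAt two_pos).div
      ((isEtaLike_etaAt one_pos).mul (isEtaLike_etaAt four_pos)))
  refine IsEtaLike.hasQSeries (f := Ppod α) key ?_
  rw [hm]; push_cast; omega

theorem hasQSeries_Ppobar (α : ℕ) : ∃ a, HasQSeries (Ppobar α) a := by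
  have hpos : 0 < 3 ^ (2 * α + 1) := by positivity
  obtain ⟨m, hm⟩ := three_pow_odd α
  have e : ∀ c : ℕ, 0 < c → IsEtaLike ((c * 3 ^ (2 * α + 1) : ℕ) : ℤ) (etaAt (c * 3 ^ (2 * α + 1))) :=
    fun c hc => isEtaLike_etaAt (Nat.mul_pos hc hpos)
  have e1 := isEtaLike_etaAt hpos
  have key := (((e 6 (by norm_num)).mul (e 12 (by norm_num))).div (e1.pow 2)).mul
    (((isEtaLike_etaAt two_pos).pow 3).div
      (((isEtaLike_etaAt one_pos).pow 2).mul (isEtaLike_etaAt four_pos)))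
  refine IsEtaLike.hasQSeries (f := Ppobar α) key ?_
  rw [hm]; push_cast; omega

theorem hasQSeries_Ppbar (α : ℕ) : ∃ a, HasQSeries (Ppbar α) a := by
  have hpos : 0 < 3 ^ (2 * α + 1) := by positivity
  obtain ⟨m, hm⟩ := three_pow_odd α
  have e : ∀ c : ℕ, 0 < c → IsEtaLike ((c * 3 ^ (2 * α + 1) : ℕ) : ℤ) (etaAt (c * 3 ^ (2 * α + 1))) :=
    fun c hc => isEtaLike_etaAt (Nat.mul_pos hc hpos)
  have e1 := isEtaLike_etaAt hpos
  have key := ((((e 2 (by norm_num)).pow 22).mul (e 12 (by norm_num))).div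
    ((((e1.pow 10).mul ((e 3 (by norm_num)).pow 2)).mul ((e 4 (by norm_num)).pow 6)).mul
    ((e 6 (by norm_num)).pow 4))).mul
    ((isEtaLike_etaAt four_pos).div ((isEtaLike_etaAt two_pos).pow 2))
  refine IsEtaLike.hasQSeries (f := Ppbar α) key ?_
  rw [hm]; push_cast; omega

/-! ### The level parameter k and the integral form of γ -/

theorem exists_level_param (β : ℕ) : ∃ k : ℕ, 3 ^ (2 * (β + 1) + 1) = 27 + 216 * k ∧
    rou (24 * ((k : ℤ) + 1)) = (-1) ^ (β + 1) := by
  induction β with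
  | zero => exact ⟨0, by norm_num, by simp [rou_24]⟩
  | succ β ih =>
    obtain ⟨k, hk, hr⟩ := ih
    -- 9(27 + 216k) = 27 + 216(9k + 1), and 9k + 1 has the opposite parity to k, so the sign
    -- alternates with α.
    refine ⟨9 * k + 1, ?_, ?_⟩
    · rw [show 2 * (β + 1 + 1) + 1 = 2 * (β + 1) + 1 + 2 by ring, pow_add, hk]; ring
    · rw [pow_succ, ← hr, ← rou_24, ← rou_add]
      apply rou_congr
      exact ⟨4 * k, by push_cast; ring⟩

theorem coe_gam_smul {α : ℕ} {k : ℤ} (hk : ((3 ^ (2 * α + 1) : ℕ) : ℤ) = 27 + 216 * k) (τ : ℍ) :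
    ((gam α • τ : ℍ) : ℂ) =
      mob (83 + 648 * k) (21 + 162 * k) (6 * (3 ^ (2 * α + 1) : ℕ)) (41 + 324 * k) τ := by
  have hR : (3 : ℝ) ^ (2 * α + 1) = 27 + 216 * k := by exact_mod_cast hk
  have hR2 : (3 : ℝ) ^ (2 * α + 2) = 3 * (27 + 216 * k) := by rw [← hR]; ring
  have hdet : 0 < (gam α).det.val := by
    rw [Matrix.GeneralLinearGroup.val_det_apply, gam_val, Matrix.det_smul, Matrix.det_fin_two_of,
      hR, hR2]
    simp
    nlinarith
  rw [UpperHalfPlane.coe_smul_of_det_pos hdet, num, denom, gam_val, mob]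
  have h2 : (2 : ℂ) ≠ 0 := two_ne_zero
  rw [← mul_div_mul_left _ (((6 * (3 ^ (2 * α + 1) : ℕ) : ℤ) : ℂ) * τ + ((41 + 324 * k : ℤ) : ℂ)) h2,
    hk, hR, hR2]
  simp
  congr 1 <;> ring

/-! ### Matching the translates of γτ with those of τ -/

section Translates

variable {α : ℕ} {k : ℤ}

/-- The translate of `γτ` which corresponds to the translate of `τ` by `8n`. -/
def linkShift (k n : ℤ) : ℤ :=
  -- With γ = (a, b; 6M, d) after halving, integrality of A requires 8md ≡ 8na - b mod M. Here ad ≡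
  -- 1, and 17 + 135k inverts 8 because 8(17 + 135k) = 1 + 5M.
  (17 + 135 * k) * (83 + 648 * k) * (8 * n * (83 + 648 * k) - (21 + 162 * k))

/-- The upper right entry of the matrix that relates the two translates. -/
def linkEntry (k n : ℤ) : ℤ :=
  6 * (21 + 162 * k) * (8 * n * (83 + 648 * k) - (21 + 162 * k))
    + 5 * (83 + 648 * k) * (41 + 324 * k) * (8 * n * (83 + 648 * k) - (21 + 162 * k))
    - 384 * linkShift k n * n

/-- The right side is the upper right entry of (1, 8m; 0, 1)γ(1, -8n; 0, 1); its divisibility by M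
is what makes A integral. -/
theorem mul_linkEntry (k n : ℤ) : (27 + 216 * k) * linkEntry k n =
    21 + 162 * k + 8 * linkShift k n * (41 + 324 * k)
      - (83 + 648 * k + 8 * linkShift k n * (6 * (27 + 216 * k))) * (8 * n) := by
  unfold linkEntry linkShift; ring

/-- The shifts are multiples of 8 and γ has lower left entry 6M, so the diagonal moves by multiples
of 48. Taking n ≤ 0 keeps the last entry positive. -/
theorem linkMatrix (hk : ((3 ^ (2 * α + 1) : ℕ) : ℤ) = 27 + 216 * k) (hk0 : 0 ≤ k) {n : ℤ}
    (hn : n ≤ 0) :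
    LinkMatrix (3 ^ (2 * α + 1) : ℕ) k
      (83 + 648 * k + 48 * (27 + 216 * k) * linkShift k n) (linkEntry k n)
      (41 + 324 * k - 48 * (27 + 216 * k) * n) where
  hM := hk
  ha := ⟨(27 + 216 * k) * linkShift k n, by ring⟩
  hd := ⟨-((27 + 216 * k) * n), by ring⟩
  det := by
    rw [hk]
    linear_combination (-6 * (27 + 216 * k)) * mul_linkEntry k n
  pos := by nlinarith [mul_nonneg (by linarith : (0 : ℤ) ≤ 27 + 216 * k) (neg_nonneg.2 hn)]

/-- A is the product (1, 8m; 0, M) γ (1, 8n; 0, M)⁻¹. -/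
theorem transDiv_gam_smul [NeZero (3 ^ (2 * α + 1))]
    (hk : ((3 ^ (2 * α + 1) : ℕ) : ℤ) = 27 + 216 * k) (n : ℤ) (τ : ℍ) :
    (transDiv (3 ^ (2 * α + 1)) (gam α • τ) (8 * linkShift k n) : ℂ) =
      mob (83 + 648 * k + 48 * (27 + 216 * k) * linkShift k n) (linkEntry k n)
        (6 * ((3 ^ (2 * α + 1) : ℕ) : ℤ) ^ 2) (41 + 324 * k - 48 * (27 + 216 * k) * n)
        (transDiv (3 ^ (2 * α + 1)) τ (8 * n)) := by
  have hC : ((3 ^ (2 * α + 1) : ℕ) : ℂ) = 27 + 216 * k := by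
    exact_mod_cast congrArg (Int.cast (R := ℂ)) hk
  have hM : (27 + 216 * k : ℂ) ≠ 0 := by
    rw [← hC]; exact_mod_cast NeZero.ne (3 ^ (2 * α + 1))
  have hB : (27 + 216 * k : ℂ) * linkEntry k n = 21 + 162 * k + 8 * linkShift k n * (41 + 324 * k)
      - (83 + 648 * k + 8 * linkShift k n * (6 * (27 + 216 * k))) * (8 * n) := by
    exact_mod_cast congrArg (Int.cast (R := ℂ)) (mul_linkEntry k n)
  have hdet : (83 + 648 * k) * (41 + 324 * k) - (21 + 162 * k) * (6 * (27 + 216 * k)) = 1 := by ring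
  have hden := mob_denom_ne_zero hdet τ.im_pos
  rw [coe_transDiv, coe_transDiv, coe_gam_smul hk, mob, mob, hk, hC]
  push_cast at hden ⊢
  have hden2 : (6 * (27 + 216 * k : ℂ) ^ 2 * ((τ + 8 * n) / (27 + 216 * k))
      + (41 + 324 * k - 48 * (27 + 216 * k) * n)) = 6 * (27 + 216 * k) * τ + (41 + 324 * k) := by
    field_simp; ring
  rw [hden2, eq_div_iff hden, div_mul_eq_mul_div, div_eq_iff hM, add_mul, div_mul_cancel₀ _ hden]
  have hcancel : (τ + 8 * n : ℂ) / (27 + 216 * k) * (27 + 216 * k) = τ + 8 * n :=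
    div_mul_cancel₀ _ hM
  linear_combination (-(83 + 648 * k + 48 * (27 + 216 * k) * linkShift k n : ℂ)) * hcancel - hB

theorem isUnit_eight_mul (hk : ((3 ^ (2 * α + 1) : ℕ) : ℤ) = 27 + 216 * k) :
    ((17 + 135 * k : ℤ) : ZMod (3 ^ (2 * α + 1))) * 8 = 1 := by
  have h : ((17 + 135 * k) * 8 : ℤ) = 1 + 5 * ((3 ^ (2 * α + 1) : ℕ) : ℤ) := by rw [hk]; ring
  have := congrArg (Int.cast (R := ZMod (3 ^ (2 * α + 1)))) h
  rw [Int.cast_add, Int.cast_mul, Int.cast_mul, Int.cast_natCast, ZMod.natCast_self, mul_zero,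
    add_zero] at this
  simpa using this

theorem injective_shift [NeZero (3 ^ (2 * α + 1))]
    (hk : ((3 ^ (2 * α + 1) : ℕ) : ℤ) = 27 + 216 * k) :
    Function.Injective fun x : ZMod (3 ^ (2 * α + 1)) =>
      ((8 * -(x.val : ℤ) : ℤ) : ZMod (3 ^ (2 * α + 1))) := by
  intro x y h
  have h1 : (8 : ZMod (3 ^ (2 * α + 1))) * -x = 8 * -y := by simpa using h
  have h8 := isUnit_eight_mul hk
  have h2 : -x = -y := by
    linear_combination ((17 + 135 * k : ℤ) : ZMod (3 ^ (2 * α + 1))) * h1 + (x - y) * h8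
  exact neg_injective h2

theorem injective_linkShift [NeZero (3 ^ (2 * α + 1))]
    (hk : ((3 ^ (2 * α + 1) : ℕ) : ℤ) = 27 + 216 * k) :
    Function.Injective fun x : ZMod (3 ^ (2 * α + 1)) =>
      ((8 * linkShift k (-(x.val : ℤ)) : ℤ) : ZMod (3 ^ (2 * α + 1))) := by
  intro x y h
  have h8 := isUnit_eight_mul hk
  have hM : (27 + 216 * k : ZMod (3 ^ (2 * α + 1))) = 0 := by
    have := congrArg (Int.cast (R := ZMod (3 ^ (2 * α + 1)))) hk
    rw [Int.cast_natCast, ZMod.natCast_self] at this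
    push_cast at this
    exact this.symm
  have h1 : (8 : ZMod (3 ^ (2 * α + 1))) * ((17 + 135 * k) * (83 + 648 * k) *
      (8 * -x * (83 + 648 * k) - (21 + 162 * k))) = 8 * ((17 + 135 * k) * (83 + 648 * k) *
      (8 * -y * (83 + 648 * k) - (21 + 162 * k))) := by
    simpa [linkShift] using h
  push_cast at h8
  have h2 : (8 : ZMod (3 ^ (2 * α + 1))) * (x - y) * (83 + 648 * k) ^ 2 = 0 := by
    linear_combination -h1 - 8 * (x - y) * (83 + 648 * k) ^ 2 * h8
  -- 83 + 648k = 2 + 3M, so its square is 4 modulo M.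
  have h3 : (x - y) * (2 : ZMod (3 ^ (2 * α + 1))) ^ 2 = 0 := by
    linear_combination (17 + 135 * k) * h2 - (x - y) * (83 + 648 * k) ^ 2 * h8
      - (x - y) * (85 + 648 * k) * 3 * hM
  have h4 : x - y = 0 := by
    linear_combination 2 * (17 + 135 * k) * h3 - (x - y) * h8
  exact sub_eq_zero.1 h4

theorem Pped_transform [NeZero (3 ^ (2 * α + 1))]
    (hk : ((3 ^ (2 * α + 1) : ℕ) : ℤ) = 27 + 216 * k) (hk0 : 0 ≤ k) {n : ℤ} (hn : n ≤ 0) (τ : ℍ) :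
    Pped α (transDiv (3 ^ (2 * α + 1)) (gam α • τ) (8 * linkShift k n)) =
      rou (24 * (k + 1)) * Ppobar α (transDiv (3 ^ (2 * α + 1)) τ (8 * n)) :=
  (linkMatrix hk hk0 hn).ped_transform (transDiv _ τ (8 * n)).im_pos (transDiv_gam_smul hk n τ)

theorem Ppod_transform [NeZero (3 ^ (2 * α + 1))]
    (hk : ((3 ^ (2 * α + 1) : ℕ) : ℤ) = 27 + 216 * k) (hk0 : 0 ≤ k) {n : ℤ} (hn : n ≤ 0) (τ : ℍ) :
    Ppod α (transDiv (3 ^ (2 * α + 1)) (gam α • τ) (8 * linkShift k n)) =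
      rou (24 * (k + 1)) * (1 / 4) * Ppbar α (transDiv (3 ^ (2 * α + 1)) τ (8 * n)) :=
  -- The square needed for the Jacobi symbols is 3M = 3^(2α+2).
  (linkMatrix hk hk0 hn).pod_transform (N := 3 ^ (α + 1)) (by push_cast; ring)
    (transDiv _ τ (8 * n)).im_pos (transDiv_gam_smul hk n τ)

end Translates

end PartitionLink

theorem theorem1p1 (α : ℕ) (hα : 1 ≤ α) :
    PartitionLink.act (PartitionLink.Lped α) (PartitionLink.gam α)
        = ((-1 : ℂ) ^ α) • PartitionLink.Lpobar α
      ∧ PartitionLink.act (PartitionLink.Lpod α) (PartitionLink.gam α)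
        = ((-1 : ℂ) ^ α * (1 / 4)) • PartitionLink.Lpbar α := by
  obtain ⟨β, rfl⟩ := Nat.exists_eq_add_of_le' hα
  obtain ⟨k, hk, hr⟩ := PartitionLink.exists_level_param β
  have hkZ : ((3 ^ (2 * (β + 1) + 1) : ℕ) : ℤ) = 27 + 216 * (k : ℤ) := by exact_mod_cast hk
  have : NeZero (3 ^ (2 * (β + 1) + 1)) := ⟨by positivity⟩
  -- The negatives of the standard representatives are used, since `linkMatrix` needs nonpositive
  -- shifts.
  have hn : ∀ x : ZMod (3 ^ (2 * (β + 1) + 1)), -(x.val : ℤ) ≤ 0 := fun x => by omega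
  obtain ⟨a₁, h₁⟩ := PartitionLink.hasQSeries_Pped (β + 1)
  obtain ⟨a₂, h₂⟩ := PartitionLink.hasQSeries_Ppod (β + 1)
  obtain ⟨a₃, h₃⟩ := PartitionLink.hasQSeries_Ppobar (β + 1)
  obtain ⟨a₄, h₄⟩ := PartitionLink.hasQSeries_Ppbar (β + 1)
  rw [← hr]
  constructor <;> funext τ
  · exact PartitionLink.iterate_U_link h₁ h₃ (by norm_num) _ _ _ τ
      (PartitionLink.injective_linkShift hkZ) (PartitionLink.injective_shift hkZ)
      fun x => PartitionLink.Pped_transform hkZ (by omega) (hn x) τ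
  · exact PartitionLink.iterate_U_link h₂ h₄ (by norm_num) _ _ _ τ
      (PartitionLink.injective_linkShift hkZ) (PartitionLink.injective_shift hkZ)
      fun x => PartitionLink.Ppod_transform hkZ (by omega) (hn x) τ
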